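/- All chains are taken in $\mathbb R^3$ with coefficients in $\mathbb Z_2$, and $k\ge 0$. **Polyhedral and flat chains.** Let $\mathbf P_k=\mathbf P_k(\mathbb Z)\otimes\mathbb Z_2$ be the group of polyhedral $k$-chains modulo two in $\mathbb R^3$ (with $\mathbf P_{-1}=0$), $\partial$ the boundary, and $M(P)=\sum_i M(\sigma_i)$ the mass of $P=\sum_i\sigma_i$, the $\sigma_i$ being nonoverlapping $k$-cells with $k$-volumes $M(\sigma_i)$. The flat norm is $M_\flat(P)=\inf\{M(Q)+M(R): P=Q+\partial R,\ Q\in\mathbf P_k,\ R\in\mathbf P_{k+1}\}$. A flat $k$-chain is an element of the completion of $\mathbf P_k$ in $M_\flat$, and its mass is $M(B)=\inf\{\liminf_i M(P_i): P_i\in\mathbf P_k,\ P_i\to B \text{ in } M_\flat\}\in[0,\infty]$. **Dipolyhedra.** Let $v=(0,0,0,1)\in\mathbb R^4$. For a $j$-cell $\sigma$ in $\mathbb R^3=\mathbb R^3\times\{0\}$ the mass cell is $\mu\sigma=\lim_{h\to0}\frac1h\,([0,hv]\times\sigma)$, a $(j+1)$-dimensional current in $\mathbb R^4$, and the dipole cell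 is $\delta\sigma=\partial\mu\sigma+\mu\partial\sigma$, a $j$-dimensional current. Let $\mathbf S_k(\mathbb Z)$ be the group generated by the dipole cells $\delta\sigma$ of $k$-cells $\sigma$, and $\mathbf T_k(\mathbb Z)$ the group generated by the mass cells $\mu\sigma$ of $(k-1)$-cells $\sigma$ (so $\mathbf T_0(\mathbb Z)=0$). Put $\mathbf D_k=(\mathbf S_k(\mathbb Z)\oplus\mathbf T_k(\mathbb Z))\otimes\mathbb Z_2$, the group of $k$-dipolyhedra. The energy of $D=\sum_i\delta\sigma_i+\sum_j\mu\tau_j$, with the $\sigma_i$ nonoverlapping and the $\tau_j$ nonoverlapping, is $E(D)=\sum_i M(\sigma_i)+\sum_j M(\tau_j)$, and $E_\flat(D)=\inf\{E(Q)+E(R): D=Q+\partial R,\ Q\in\mathbf D_k,\ R\in\mathbf D_{k+1}\}$. A flat $k$-dipolyhedron is an element of the completion $\mathcal D_k$ of $\mathbf D_k$ in $E_\flat$, and its energy is $E(A)=\inf\{\liminf_i E(D_i): D_i\in\mathbf D_k,\ D_i\to A\text{ in }E_\flat\}\in[0,\infty]$. The operators $\delta$ and $\mu$ on polyhedral chains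 extend by continuity to $\delta$ from flat $k$-chains to flat $k$-dipolyhedra and $\mu$ from flat $(k-1)$-chains to flat $k$-dipolyhedra. **Theorem.** For every flat $k$-dipolyhedron $A$ there are a unique flat $k$-chain $B$ and a unique flat $(k-1)$-chain $C$ with $A=\delta B+\mu C$ (for $k=0$ the term $\mu C$ is absent), and $$E(A)=M(B)+M(C).$$ Let moreover $D_i=\delta B_i+\mu C_i$ be a sequence of $k$-dipolyhedra ($B_i\in\mathbf P_k$, $C_i\in\mathbf P_{k-1}$) with $D_i\to A$ in $E_\flat$ and $E(D_i)\to E(A)$. Then $B_i\to B$ and $C_i\to C$ in $M_\flat$ and, if $E(A)<\infty$, also $M(B_i)\to M(B)$ and $M(C_i)\to M(C)$. For $k=0$, where only $B$ is present, $M(B_i)\to M(B)$ holds without the condition $E(A)<\infty$. The same holds for sequences $D_i=\delta B_i+\mu C_i$ of flat $k$-dipolyhedra, with flat chains $B_i$ and $C_i$. -/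

import Mathlib

open MeasureTheory Filter Topology
open scoped TensorProduct

noncomputable section

namespace Dipole

/-- The standard corner simplex. -/
def corner (k : ℕ) : Set (Fin k → ℝ) := {t | (∀ i, 0 ≤ t i) ∧ ∑ i, t i ≤ 1}

theorem isCompact_corner (k : ℕ) : IsCompact (corner k) := by
  have hc : IsClosed (corner k) := by
    have : corner k = (⋂ i, {t | 0 ≤ t i}) ∩ {t | ∑ i, t i ≤ 1} := by
      ext t; simp [corner]
    rw [this]
    refine (isClosed_iInter fun i => isClosed_le (by fun_prop) (by fun_prop)).inter
      (isClosed_le (by fun_prop) (by fun_prop))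
  refine (isCompact_Icc (a := (0 : Fin k → ℝ)) (b := 1)).of_isClosed_subset hc ?_
  intro t ht
  refine ⟨fun i => ht.1 i, fun i => ?_⟩
  exact (Finset.single_le_sum (fun j _ => ht.1 j) (Finset.mem_univ i)).trans ht.2

theorem measurableSet_corner (k : ℕ) : MeasurableSet (corner k) :=
  (isCompact_corner k).isClosed.measurableSet

theorem integrableOn_corner {k : ℕ} {h : (Fin k → ℝ) → ℝ} (hh : Continuous h) :
    IntegrableOn h (corner k) :=
  hh.continuousOn.integrableOn_compact (isCompact_corner k)

theorem insertNth_mem_corner {k : ℕ} (j : Fin (k + 1)) (s : ℝ) (t : Fin k → ℝ) :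
    (j.insertNth s t : Fin (k + 1) → ℝ) ∈ corner (k + 1) ↔
      t ∈ corner k ∧ s ∈ Set.Icc 0 (1 - ∑ i, t i) := by
  simp only [corner, Set.mem_ofPred_eq, Fin.forall_iff_succAbove j, Fin.insertNth_apply_same,
    Fin.insertNth_apply_succAbove, Fin.sum_univ_succAbove _ j, Set.mem_Icc]
  constructor
  · rintro ⟨⟨h0, h1⟩, h2⟩
    exact ⟨⟨h1, by linarith⟩, h0, by linarith⟩
  · rintro ⟨⟨h1, h2⟩, h0, h3⟩
    exact ⟨⟨h0, h1⟩, by linarith⟩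

theorem corner_fubini {k : ℕ} (j : Fin (k + 1)) {h : (Fin (k + 1) → ℝ) → ℝ} (hh : Continuous h) :
    ∫ t in corner (k + 1), h t =
      ∫ t in corner k, ∫ s in (0 : ℝ)..(1 - ∑ i, t i), h (j.insertNth s t) := by
  have vp := (volume_preserving_piFinSuccAbove (fun _ : Fin (k + 1) => ℝ) j).symm
  have hint : Integrable ((corner (k + 1)).indicator h) :=
    (integrable_indicator_iff (measurableSet_corner _)).2 (integrableOn_corner hh)
  rw [← integral_indicator (measurableSet_corner _), ← vp.integral_comp', Measure.volume_eq_prod,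
    integral_prod_symm, ← integral_indicator (measurableSet_corner _)]
  · congr 1
    ext t
    have key : ∀ s : ℝ, (corner (k + 1)).indicator h
        ((MeasurableEquiv.piFinSuccAbove (fun _ => ℝ) j).symm (s, t)) =
        (corner k).indicator (fun t => (Set.Icc 0 (1 - ∑ i, t i)).indicator
          (fun s => h (j.insertNth s t)) s) t := by
      intro s
      have e : (MeasurableEquiv.piFinSuccAbove (fun _ => ℝ) j).symm (s, t) =
        (j.insertNth s t : Fin (k + 1) → ℝ) := rfl
      rw [e]
      by_cases h1 : t ∈ corner k
      · by_cases h2 : s ∈ Set.Icc 0 (1 - ∑ i, t i)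
        · rw [Set.indicator_of_mem ((insertNth_mem_corner j s t).2 ⟨h1, h2⟩),
            Set.indicator_of_mem h1, Set.indicator_of_mem h2]
        · rw [Set.indicator_of_notMem (fun H => h2 ((insertNth_mem_corner j s t).1 H).2),
            Set.indicator_of_mem h1, Set.indicator_of_notMem h2]
      · rw [Set.indicator_of_notMem (fun H => h1 ((insertNth_mem_corner j s t).1 H).1),
            Set.indicator_of_notMem h1]
    simp_rw [key]
    by_cases h1 : t ∈ corner k
    · simp only [Set.indicator_of_mem h1]
      rw [integral_indicator measurableSet_Icc, integral_Icc_eq_integral_Ioc,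
        intervalIntegral.integral_of_le]
      linarith [h1.2]
    · simp [Set.indicator_of_notMem h1]
  · rw [← Measure.volume_eq_prod]
    exact (vp.integrable_comp_emb (MeasurableEquiv.measurableEmbedding _)).2 hint

theorem sum_update_reflect {k : ℕ} (j : Fin k) (c : ℝ) (t : Fin k → ℝ) :
    ∑ i, Function.update t j (c - ∑ i, t i) i = c - t j := by
  rw [Finset.sum_update_of_mem (Finset.mem_univ j)]
  have := Finset.sum_erase_add (Finset.univ) t (Finset.mem_univ j)
  rw [← Finset.erase_eq] 
  linarith

theorem measurePreserving_reflect {k : ℕ} (j : Fin k) :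
    MeasurePreserving (fun t : Fin k → ℝ => Function.update t j (1 - ∑ i, t i)) := by
  let L : (Fin k → ℝ) →ₗ[ℝ] (Fin k → ℝ) :=
    { toFun := fun t => Function.update t j (0 - ∑ i, t i)
      map_add' := fun s t => by
        ext i
        by_cases h : i = j
        · subst h; simp [Finset.sum_add_distrib]; ring
        · simp [h]
      map_smul' := fun c t => by
        ext i
        by_cases h : i = j
        · subst h; simp [Finset.mul_sum]
        · simp [h] }
  have hL : L ∘ₗ L = LinearMap.id := by
    ext1 x
    ext1
    ext i
    simp only [LinearMap.comp_apply, LinearMap.id_apply, L, LinearMap.coe_mk, AddHom.coe_mk,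
      sum_update_reflect]
    by_cases h : i = j
    · subst h; simp
    · simp [h]
  have hdet : LinearMap.det L * LinearMap.det L = 1 := by
    rw [← LinearMap.det_comp, hL, LinearMap.det_id]
  have hne : LinearMap.det L ≠ 0 := fun h => by simp [h] at hdet
  have habs : |(LinearMap.det L)⁻¹| = 1 := by
    rw [abs_inv, inv_eq_one]
    have : |LinearMap.det L| * |LinearMap.det L| = 1 := by rw [← abs_mul, hdet, abs_one]
    nlinarith [abs_nonneg (LinearMap.det L)]
  have hm : MeasurePreserving L := by
    refine ⟨(LinearMap.continuous_of_finiteDimensional L).measurable, ?_⟩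
    rw [Measure.map_linearMap_addHaar_eq_smul_addHaar _ hne, habs]
    simp
  have := (measurePreserving_add_right volume (Pi.single j (1 : ℝ))).comp hm
  have e : (fun t : Fin k → ℝ => Function.update t j (1 - ∑ i, t i)) =
      (fun x => x + Pi.single j (1 : ℝ)) ∘ L := by
    funext t
    funext i
    by_cases h : i = j
    · subst h; simp [L]; ring
    · simp [L, h]
  rw [e]
  exact this

theorem corner_swap {k : ℕ} (j : Fin k) (h : (Fin (k + 1) → ℝ) → ℝ) :
    ∫ t in corner k, h (j.castSucc.insertNth (1 - ∑ i, t i) t) =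
      ∫ t in corner k, h (j.succ.insertNth (1 - ∑ i, t i) t) := by
  let ψ : (Fin k → ℝ) → (Fin k → ℝ) := fun t => Function.update t j (1 - ∑ i, t i)
  have hψ : Function.Involutive ψ := by
    intro t
    simp only [ψ, sum_update_reflect]
    simp
  have hm : MeasurePreserving ψ := measurePreserving_reflect j
  have he : MeasurableEmbedding ψ :=
    (MeasurableEquiv.mk hψ.toPerm hm.measurable hm.measurable).measurableEmbedding
  have hpre : ψ ⁻¹' corner k = corner k := by
    have sub : ∀ t ∈ corner k, ψ t ∈ corner k := by
      rintro t ⟨h0, h1⟩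
      refine ⟨fun i => ?_, ?_⟩
      · by_cases hi : i = j
        · subst hi; simp [ψ]; linarith
        · simp [ψ, hi, h0 i]
      · simp only [ψ, sum_update_reflect]
        linarith [h0 j]
    ext t
    exact ⟨fun H => by simpa [hψ t] using sub _ H, sub t⟩
  conv_rhs => rw [← hm.setIntegral_preimage_emb he, hpre]
  congr 1
  ext t
  congr 1
  have hs : 1 - ∑ i, ψ t i = t j := by simp only [ψ, sum_update_reflect]; ring
  rw [hs]
  ext x
  rcases Fin.eq_self_or_eq_succAbove j.succ x with rfl | ⟨i, rfl⟩
  · rw [Fin.insertNth_apply_same]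
    have : j.succ = j.castSucc.succAbove j := by simp
    rw [this, Fin.insertNth_apply_succAbove]
  · rw [Fin.insertNth_apply_succAbove]
    by_cases hi : i = j
    · subst hi
      have : i.succ.succAbove i = i.castSucc := by simp
      rw [this, Fin.insertNth_apply_same]
      simp [ψ]
    · have : j.succ.succAbove i = j.castSucc.succAbove i := by
        rcases lt_or_gt_of_ne hi with h | h
        · rw [Fin.succAbove_of_castSucc_lt, Fin.succAbove_of_castSucc_lt] <;>
            simp only [Fin.lt_def, Fin.val_castSucc, Fin.val_succ] at * <;> omega
        · rw [Fin.succAbove_of_le_castSucc, Fin.succAbove_of_le_castSucc] <;>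
            simp only [Fin.lt_def, Fin.le_def, Fin.val_castSucc, Fin.val_succ] at * <;> omega
      rw [this, Fin.insertNth_apply_succAbove]
      simp [ψ, hi]

theorem corner_facet {k : ℕ} (j : Fin (k + 1)) (h : (Fin (k + 1) → ℝ) → ℝ) :
    ∫ t in corner k, h (j.insertNth (1 - ∑ i, t i) t) =
      ∫ t in corner k, h (Fin.cons (1 - ∑ i, t i) t) := by
  induction j using Fin.induction with
  | zero => simp [Fin.insertNth_zero']
  | succ i ih => rw [← corner_swap i h, ih]

theorem alternating_sub {E : Type*} [NormedAddCommGroup E] [NormedSpace ℝ E] {k : ℕ}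
    (f : E [⋀^Fin k]→L[ℝ] ℝ) (v : Fin (k + 1) → E) :
    f (fun i => v i.succ - v 0) = ∑ j : Fin (k + 1), (-1 : ℝ) ^ (j : ℕ) * f (j.removeNth v) := by
  let f' : (ℝ × E) [⋀^Fin k]→L[ℝ] ℝ := f.compContinuousLinearMap (ContinuousLinearMap.snd ℝ ℝ E)
  let F : (ℝ × E) →L[ℝ] (ℝ × E) [⋀^Fin k]→L[ℝ] ℝ :=
    (ContinuousLinearMap.fst ℝ ℝ E).smulRight f'
  let Ω := ContinuousAlternatingMap.alternatizeUncurryFin F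
  let w : Fin (k + 1) → ℝ × E := fun i => (1, v i)
  have h1 : Ω w = ∑ j : Fin (k + 1), (-1 : ℝ) ^ (j : ℕ) * f (j.removeNth v) := by
    simp only [Ω, ContinuousAlternatingMap.alternatizeUncurryFin_apply]
    refine Finset.sum_congr rfl fun j _ => ?_
    simp [F, w, f', Function.comp_def]
    rfl
  have h2 : Ω (Fin.cons (w 0) fun i => w i.succ - w 0) = f (fun i => v i.succ - v 0) := by
    simp only [Ω, ContinuousAlternatingMap.alternatizeUncurryFin_apply]
    rw [Fin.sum_univ_succ, Finset.sum_eq_zero]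
    · simp [F, w, f', Function.comp_def]
    · intro i _
      simp [F, w]
  rw [← h1, ← h2]
  -- subtracting the first vector from the others does not change the value
  have h3 : w = Fin.cons (w 0) (fun i => w i.succ) := (Fin.cons_self_tail w).symm
  set ξ := ContinuousAlternatingMap.curryLeft Ω (w 0) with hξ
  have e1 : ∀ u : Fin k → ℝ × E, Ω (Fin.cons (w 0) u) = ξ u := fun u => rfl
  conv_rhs => rw [h3]
  rw [e1, e1]
  have e2 : ∀ (u : Fin k → ℝ × E) (i : Fin k), u i = - w 0 → ξ u = 0 := by
    intro u i hi
    have : u = Function.update u i (-(w 0)) := by rw [← hi]; simp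
    rw [this]
    have := ξ.toMultilinearMap.map_update_neg u i (w 0)
    have h4 : ξ (Function.update u i (w 0)) = 0 := by
      rw [← e1]
      refine Ω.map_eq_zero_of_eq _ (i := 0) (j := i.succ) ?_ (Fin.succ_ne_zero i).symm
      simp
    have h5 : ξ (Function.update u i (-(w 0))) = - ξ (Function.update u i (w 0)) := this
    rw [h5, h4, neg_zero]
  have := ξ.toMultilinearMap.map_add_univ (fun i => w i.succ) (fun _ => - w 0)
  have h6 : ξ (fun i => w i.succ - w 0) = ∑ s : Finset (Fin k), ξ (s.piecewise (fun i => w i.succ) (fun _ => - w 0)) := by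
    rw [← show ((fun i => w i.succ) + fun _ => - w 0) = (fun i : Fin k => w i.succ - w 0) from by
      ext i <;> simp [sub_eq_add_neg]]
    exact this
  rw [h6, Finset.sum_eq_single Finset.univ]
  · simp
  · intro s _ hs
    obtain ⟨i, hi⟩ : ∃ i, i ∉ s := by
      by_contra H
      push Not at H
      exact hs (Finset.eq_univ_iff_forall.2 H)
    exact e2 _ i (by simp [hi])
  · simp

section Currents

variable {E : Type*} [NormedAddCommGroup E] [NormedSpace ℝ E]

variable (E) in
/-- Smooth differential `k`-forms on `E`. -/
def Form (k : ℕ) : Submodule ℝ (E → E [⋀^Fin k]→L[ℝ] ℝ) where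
  carrier := {η | ContDiff ℝ ((⊤ : ℕ∞) : WithTop ℕ∞) η}
  add_mem' ha hb := by rw [Set.mem_ofPred_eq] at *; exact ha.add hb
  zero_mem' := by rw [Set.mem_ofPred_eq]; exact contDiff_const
  smul_mem' c _ ha := by rw [Set.mem_ofPred_eq] at *; exact ha.const_smul c

theorem form_contDiff {k : ℕ} (η : Form E k) : ContDiff ℝ ((⊤ : ℕ∞) : WithTop ℕ∞) η.1 := by
  have h : η.1 ∈ {η : E → E [⋀^Fin k]→L[ℝ] ℝ | ContDiff ℝ ((⊤ : ℕ∞) : WithTop ℕ∞) η} := η.2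
  rwa [Set.mem_ofPred_eq] at h

theorem form_differentiable {k : ℕ} (η : Form E k) : Differentiable ℝ η.1 :=
  (form_contDiff η).differentiable (by simp)

theorem contDiff_extDeriv {k : ℕ} (η : Form E k) :
    ContDiff ℝ ((⊤ : ℕ∞) : WithTop ℕ∞) (extDeriv η.1) := by
  change ContDiff ℝ _ fun x =>
    ContinuousAlternatingMap.alternatizeUncurryFinCLM (n := k) ℝ E ℝ (fderiv ℝ η.1 x)
  exact ContinuousLinearMap.contDiff _ |>.comp
    ((form_contDiff η).fderiv_right (m := ((⊤ : ℕ∞) : WithTop ℕ∞)) (by simp))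

/-- The exterior derivative of smooth forms. -/
def extD (k : ℕ) : Form E k →ₗ[ℝ] Form E (k + 1) where
  toFun η := ⟨extDeriv η.1, contDiff_extDeriv η⟩
  map_add' a b := by
    ext1
    funext x
    exact extDeriv_add ((form_differentiable a) x) ((form_differentiable b) x)
  map_smul' c a := by
    ext1
    funext x
    exact extDeriv_smul c a.1

theorem extD_extD {k : ℕ} (η : Form E k) : extD (k + 1) (extD k η) = 0 := by
  ext1
  exact extDeriv_extDeriv (form_contDiff η)
    (by rw [minSmoothness_of_isRCLikeNormedField]; exact WithTop.coe_le_coe.2 le_top)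

variable (E) in
/-- `k`-dimensional currents, taken as all linear functionals on smooth `k`-forms.  Every current
below is built from integrals over compact simplices. -/
abbrev Current (k : ℕ) : Type _ := Form E k →ₗ[ℝ] ℝ

/-- The boundary of a current, `∂T(η) = T(dη)`. -/
def bdry (k : ℕ) : Current E (k + 1) →ₗ[ℝ] Current E k where
  toFun T := T ∘ₗ extD k
  map_add' _ _ := rfl
  map_smul' _ _ := rfl

@[simp] theorem bdry_apply {k : ℕ} (T : Current E (k + 1)) (η : Form E k) :
    bdry k T η = T (extD k η) := rfl

theorem bdry_bdry {k : ℕ} (T : Current E (k + 2)) : bdry k (bdry (k + 1) T) = 0 := by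
  ext η
  simp [extD_extD]

variable (E) in
/-- An ordered (possibly degenerate) affine `k`-simplex in `E`, given by its vertices. -/
abbrev Simplex (k : ℕ) : Type _ := Fin (k + 1) → E

/-- The edge vectors `σ_{i+1} - σ_0`. -/
def Simplex.edge {k : ℕ} (σ : Simplex E k) (i : Fin k) : E := σ i.succ - σ 0

/-- The affine parametrization of a simplex by the standard corner simplex. -/
def Simplex.param {k : ℕ} (σ : Simplex E k) (t : Fin k → ℝ) : E := σ 0 + ∑ i, t i • σ.edge i

/-- The facet opposite to the `i`-th vertex. -/
def Simplex.face {k : ℕ} (σ : Simplex E (k + 1)) (i : Fin (k + 2)) : Simplex E k :=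
  fun j => σ (i.succAbove j)

theorem Simplex.continuous_param {k : ℕ} (σ : Simplex E k) : Continuous σ.param := by
  unfold Simplex.param; fun_prop

theorem form_continuous_apply {k : ℕ} (η : Form E k) (v : Fin k → E) :
    Continuous fun x => η.1 x v :=
  (ContinuousAlternatingMap.apply ℝ E ℝ v).continuous.comp (form_contDiff η).continuous

/-- Integration of `k`-forms over an ordered affine `k`-simplex. -/
def simplexCurrent {k : ℕ} (σ : Simplex E k) : Current E k where
  toFun η := ∫ t in corner k, η.1 (σ.param t) σ.edge
  map_add' a b := integral_add
    (integrableOn_corner (((form_continuous_apply a) _).comp σ.continuous_param))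
    (integrableOn_corner (((form_continuous_apply b) _).comp σ.continuous_param))
  map_smul' c _ := integral_const_mul c _

theorem simplexCurrent_apply {k : ℕ} (σ : Simplex E k) (η : Form E k) :
    simplexCurrent σ η = ∫ t in corner k, η.1 (σ.param t) σ.edge := rfl

theorem stokes_term {k : ℕ} (σ : Simplex E (k + 1)) (η : Form E k) (j : Fin (k + 1)) :
    ∫ t in corner (k + 1),
        fderiv ℝ (fun x => η.1 x (j.removeNth σ.edge)) (σ.param t) (σ.edge j) =
      (∫ t in corner k, η.1 ((σ.face 0).param t) (j.removeNth σ.edge)) -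
        simplexCurrent (σ.face j.succ) η := by
  set g : E → ℝ := fun x => η.1 x (j.removeNth σ.edge) with hg
  have hgc : ContDiff ℝ ((⊤ : ℕ∞) : WithTop ℕ∞) g :=
    (ContinuousAlternatingMap.apply ℝ E ℝ (j.removeNth σ.edge)).contDiff.comp (form_contDiff η)
  have hgd : Differentiable ℝ g := hgc.differentiable (by simp)
  have hcont : Continuous fun t => fderiv ℝ g (σ.param t) (σ.edge j) :=
    ((hgc.continuous_fderiv (by simp)).comp σ.continuous_param).clm_apply continuous_const
  have hins : ∀ (s : ℝ) (t : Fin k → ℝ), σ.param (j.insertNth s t) =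
      σ 0 + (s • σ.edge j + ∑ i, t i • σ.edge (j.succAbove i)) := by
    intro s t
    simp [Simplex.param, Fin.sum_univ_succAbove _ j]
  rw [corner_fubini j hcont]
  have hftc : ∀ t : Fin k → ℝ,
      ∫ s in (0 : ℝ)..(1 - ∑ i, t i), fderiv ℝ g (σ.param (j.insertNth s t)) (σ.edge j) =
        g (σ.param (j.insertNth (1 - ∑ i, t i) t)) - g (σ.param (j.insertNth 0 t)) := by
    intro t
    refine intervalIntegral.integral_eq_sub_of_hasDerivAt
      (f := fun s => g (σ.param (j.insertNth s t))) (fun s _ => ?_) ?_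
    · have h1 : HasDerivAt (fun s => σ.param (j.insertNth s t)) (σ.edge j) s := by
        simp_rw [hins]
        simpa using (((hasDerivAt_id s).smul_const (σ.edge j)).add_const
          (∑ i, t i • σ.edge (j.succAbove i))).const_add (σ 0)
      exact (hgd _).hasFDerivAt.comp_hasDerivAt s h1
    · refine Continuous.intervalIntegrable (hcont.comp ?_) _ _
      exact Continuous.finInsertNth j continuous_id continuous_const
  simp_rw [hftc]
  have hc1 : Continuous fun t : Fin k → ℝ => g (σ.param (j.insertNth (1 - ∑ i, t i) t)) :=
    hgc.continuous.comp (σ.continuous_param.comp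
      (Continuous.finInsertNth j (by fun_prop) continuous_id))
  have hc2 : Continuous fun t : Fin k → ℝ => g (σ.param (j.insertNth 0 t)) :=
    hgc.continuous.comp (σ.continuous_param.comp
      (Continuous.finInsertNth j (by fun_prop) continuous_id))
  rw [integral_sub (integrableOn_corner hc1) (integrableOn_corner hc2),
    corner_facet j (fun t => g (σ.param t))]
  congr 1
  · congr 1
    funext t
    have : σ.param (Fin.cons (1 - ∑ i, t i) t) = (σ.face 0).param t := by
      simp only [Simplex.param, Fin.sum_univ_succ, Fin.cons_zero, Fin.cons_succ, Simplex.edge,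
        Simplex.face, Fin.succAbove_zero, smul_sub, Finset.sum_sub_distrib, sub_smul,
        ← Finset.sum_smul, one_smul]
      simp only [Finset.sum_smul]
      simp
      abel
    simp only [hg, this]
  · rw [simplexCurrent_apply]
    congr 1
    funext t
    have e0 : (σ.face j.succ) 0 = σ 0 := by
      simp [Simplex.face]
    have e1 : (σ.face j.succ).edge = j.removeNth σ.edge := by
      funext i
      simp [Simplex.edge, Simplex.face, Fin.removeNth_apply, Fin.succ_succAbove_succ]
    have : σ.param (j.insertNth 0 t) = (σ.face j.succ).param t := by
      rw [hins, Simplex.param, e0, e1]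
      simp [Fin.removeNth_apply]
    simp only [hg, this, e1]

/-- Stokes' theorem for simplices: the boundary of the current of a simplex is the alternating sum
of the currents of its facets. -/
theorem bdry_simplexCurrent {k : ℕ} (σ : Simplex E (k + 1)) :
    bdry k (simplexCurrent σ) =
      ∑ i : Fin (k + 2), ((-1 : ℤ) ^ (i : ℕ)) • simplexCurrent (σ.face i) := by
  ext η
  have hcont : ∀ (v : Fin k → E), ContDiff ℝ ((⊤ : ℕ∞) : WithTop ℕ∞) fun x => η.1 x v := fun v =>
    (ContinuousAlternatingMap.apply ℝ E ℝ v).contDiff.comp (form_contDiff η)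
  have h1 : bdry k (simplexCurrent σ) η = ∑ j : Fin (k + 1), (-1 : ℝ) ^ (j : ℕ) *
      ∫ t in corner (k + 1),
        fderiv ℝ (fun x => η.1 x (j.removeNth σ.edge)) (σ.param t) (σ.edge j) := by
    rw [bdry_apply, simplexCurrent_apply]
    have : ∀ t, (extD k η).1 (σ.param t) σ.edge = ∑ j : Fin (k + 1), (-1 : ℝ) ^ (j : ℕ) *
        fderiv ℝ (fun x => η.1 x (j.removeNth σ.edge)) (σ.param t) (σ.edge j) := by
      intro t
      have := extDeriv_apply ((form_differentiable η) (σ.param t)) σ.edge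
      simpa [extD] using this
    simp_rw [this]
    rw [integral_finsetSum]
    · simp_rw [integral_const_mul]
    · intro j _
      refine integrableOn_corner (continuous_const.mul ?_)
      exact (((hcont _).continuous_fderiv (by simp)).comp σ.continuous_param).clm_apply
        continuous_const
  have h2 : simplexCurrent (σ.face 0) η = ∑ j : Fin (k + 1), (-1 : ℝ) ^ (j : ℕ) *
      ∫ t in corner k, η.1 ((σ.face 0).param t) (j.removeNth σ.edge) := by
    rw [simplexCurrent_apply]
    have : (σ.face 0).edge = fun i => σ.edge i.succ - σ.edge 0 := by
      funext i
      simp [Simplex.edge, Simplex.face]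
    rw [this]
    simp_rw [alternating_sub]
    rw [integral_finsetSum]
    · simp_rw [integral_const_mul]
    · intro j _
      refine integrableOn_corner (continuous_const.mul ?_)
      exact ((form_continuous_apply η) _).comp (Simplex.continuous_param _)
  rw [h1]
  simp_rw [stokes_term, mul_sub, Finset.sum_sub_distrib]
  rw [← h2]
  conv_rhs => rw [Fin.sum_univ_succ]
  simp [pow_succ, LinearMap.sum_apply, sub_eq_add_neg]

theorem contDiff_curryLeft {W : Type*} [NormedAddCommGroup W] [NormedSpace ℝ W] (k : ℕ) :
    ContDiff ℝ ((⊤ : ℕ∞) : WithTop ℕ∞) fun f : W [⋀^Fin (k + 1)]→L[ℝ] ℝ => f.curryLeft := by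
  have := LinearIsometry.contDiff (𝕜 := ℝ) (n := ((⊤ : ℕ∞) : WithTop ℕ∞))
    (E := W [⋀^Fin (k + 1)]→L[ℝ] ℝ) (F := W →L[ℝ] W [⋀^Fin k]→L[ℝ] ℝ)
    ContinuousAlternatingMap.curryLeftLI
  exact this

/-- Contraction of a `(k+1)`-form on `E × ℝ` with the unit vector `v = (0, 1)` (in the first slot),
restricted to `E = E × {0}`. -/
def contract (k : ℕ) : Form (E × ℝ) (k + 1) →ₗ[ℝ] Form E k where
  toFun η := ⟨fun x =>
      ((η.1 (x, 0)).curryLeft (0, 1)).compContinuousLinearMap (ContinuousLinearMap.inl ℝ E ℝ), by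
    change _ ∈ {θ : E → E [⋀^Fin k]→L[ℝ] ℝ | ContDiff ℝ ((⊤ : ℕ∞) : WithTop ℕ∞) θ}
    rw [Set.mem_ofPred_eq]
    have h1 : ContDiff ℝ ((⊤ : ℕ∞) : WithTop ℕ∞) fun x : E => η.1 (x, 0) :=
      (form_contDiff η).comp (contDiff_id.prodMk contDiff_const)
    have h2 : ContDiff ℝ ((⊤ : ℕ∞) : WithTop ℕ∞) fun x : E => (η.1 (x, 0)).curryLeft := by
      exact (contDiff_curryLeft k).comp h1
    exact (ContinuousAlternatingMap.compContinuousLinearMapCLM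
      (ContinuousLinearMap.inl ℝ E ℝ)).contDiff.comp (h2.clm_apply contDiff_const)⟩
  map_add' _ _ := rfl
  map_smul' _ _ := rfl

theorem contract_apply {k : ℕ} (η : Form (E × ℝ) (k + 1)) (x : E) (w : Fin k → E) :
    (contract k η).1 x w = η.1 (x, 0) (Fin.cons (0, 1) fun i => (w i, 0)) := by
  rfl

/-- The operator `μ` from `k`-currents in `E` to `(k+1)`-currents in `E × ℝ`. On the current of a
`k`-simplex `σ` it is the mass cell `μσ = lim_{h → 0} ([0, hv] × σ) / h`, where `v = (0, 1)`; see
`massOp_eq_lim`. -/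
def massOp (k : ℕ) : Current E k →ₗ[ℝ] Current (E × ℝ) (k + 1) where
  toFun T := T ∘ₗ contract k
  map_add' _ _ := rfl
  map_smul' _ _ := rfl

/-- The mass cell of `σ` is the limit, as `h → 0`, of `1 / h` times the current of integration over
the prism `[0, hv] × σ`. -/
theorem massOp_eq_lim {k : ℕ} (σ : Simplex E k) (η : Form (E × ℝ) (k + 1)) :
    Tendsto (fun h : ℝ => h⁻¹ * ∫ s in (0 : ℝ)..h, ∫ t in corner k,
        η.1 (σ.param t, s) (Fin.cons (0, 1) fun i => (σ.edge i, 0)))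
      (𝓝[≠] 0) (𝓝 (massOp k (simplexCurrent σ) η)) := by
  set v : Fin (k + 1) → E × ℝ := Fin.cons (0, 1) fun i => (σ.edge i, 0) with hv
  have hc : Continuous fun s : ℝ => ∫ t in corner k, η.1 (σ.param t, s) v := by
    refine continuous_parametric_integral_of_continuous
      (f := fun (s : ℝ) t => η.1 (σ.param t, s) v) ?_ (isCompact_corner k)
    have := form_continuous_apply η v
    have h2 := σ.continuous_param
    exact this.comp (by fun_prop)
  have h0 : massOp k (simplexCurrent σ) η = ∫ t in corner k, η.1 (σ.param t, 0) v := by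
    change simplexCurrent σ (contract k η) = _
    rw [simplexCurrent_apply]
    simp_rw [contract_apply]
    rfl
  have := (intervalIntegral.integral_hasDerivAt_right (hc.intervalIntegrable 0 0)
    (hc.stronglyMeasurableAtFilter _ _) hc.continuousAt).tendsto_slope_zero
  rw [h0]
  simpa using this

/-- The operator `δ = ∂μ + μ∂` from `k`-currents in `E` to `k`-currents in `E × ℝ`. On the current
of a `k`-simplex `σ` it is the dipole cell `δσ = ∂μσ + μ∂σ` (with `∂σ = 0` if `k = 0`). -/
def dipoleOp : (k : ℕ) → Current E k →ₗ[ℝ] Current (E × ℝ) k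
  | 0 => bdry 0 ∘ₗ massOp 0
  | k + 1 => bdry (k + 1) ∘ₗ massOp (k + 1) + massOp k ∘ₗ bdry k

theorem bdry_massOp_zero (T : Current E 0) : bdry 0 (massOp 0 T) = dipoleOp 0 T := rfl

theorem bdry_massOp {k : ℕ} (T : Current E (k + 1)) :
    bdry (k + 1) (massOp (k + 1) T) = dipoleOp (k + 1) T - massOp k (bdry k T) := by
  simp [dipoleOp]

theorem bdry_dipoleOp {k : ℕ} (T : Current E (k + 1)) :
    bdry k (dipoleOp (k + 1) T) = dipoleOp k (bdry k T) := by
  cases k with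
  | zero => simp [dipoleOp, bdry_bdry]
  | succ k => simp [dipoleOp, bdry_bdry]

/-- The form `s · η` on `E × ℝ`, where `s` is the last coordinate. -/
def lift {k : ℕ} (η : Form E k) : Form (E × ℝ) k :=
  ⟨fun z => z.2 • (η.1 z.1).compContinuousLinearMap (ContinuousLinearMap.fst ℝ E ℝ), by
    change _ ∈ {θ : E × ℝ → (E × ℝ) [⋀^Fin k]→L[ℝ] ℝ | ContDiff ℝ ((⊤ : ℕ∞) : WithTop ℕ∞) θ}
    rw [Set.mem_ofPred_eq]
    exact contDiff_snd.smul ((ContinuousAlternatingMap.compContinuousLinearMapCLM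
      (ContinuousLinearMap.fst ℝ E ℝ)).contDiff.comp ((form_contDiff η).comp contDiff_fst))⟩

theorem contract_lift {k : ℕ} (η : Form E (k + 1)) : contract k (lift η) = 0 := by
  ext x w
  simp [contract_apply, lift]

theorem contract_extD_lift {k : ℕ} (η : Form E k) : contract k (extD k (lift η)) = η := by
  ext x w
  rw [contract_apply]
  change extDeriv (lift η).1 (x, 0) _ = _
  rw [extDeriv_apply (form_differentiable (lift η) _)]
  have key : ∀ (u : Fin k → E × ℝ) (y : E × ℝ),
      fderiv ℝ (fun z => (lift η).1 z u) (x, 0) y = y.2 * η.1 x (fun i => (u i).1) := by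
    intro u y
    have hg : HasFDerivAt (fun z : E × ℝ => η.1 z.1 (fun i => (u i).1))
        (fderiv ℝ (fun z : E × ℝ => η.1 z.1 (fun i => (u i).1)) (x, 0)) (x, (0 : ℝ)) := by
      refine DifferentiableAt.hasFDerivAt ?_
      have : Differentiable ℝ fun x : E => η.1 x (fun i => (u i).1) :=
        (ContinuousAlternatingMap.apply ℝ E ℝ fun i => (u i).1).differentiable.comp
          (form_differentiable η)
      exact (this.comp differentiable_fst) _
    have h2 : HasFDerivAt (fun z : E × ℝ => z.2) (ContinuousLinearMap.snd ℝ E ℝ) (x, (0 : ℝ)) :=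
      hasFDerivAt_snd
    have h3 := (h2.fun_mul hg).fderiv
    have h4 : (fun z => (lift η).1 z u) = fun z : E × ℝ => z.2 * η.1 z.1 (fun i => (u i).1) := by
      funext z
      rfl
    rw [h4, h3]
    simp [mul_comm]
  rw [Fin.sum_univ_succ, Finset.sum_eq_zero]
  · simp [key]
  · intro i _
    simp [key]

theorem massOp_lift {k : ℕ} (T : Current E k) (η : Form E (k + 1)) : massOp k T (lift η) = 0 := by
  change T (contract k (lift η)) = 0
  rw [contract_lift, map_zero]

theorem massOp_extD_lift {k : ℕ} (T : Current E k) (η : Form E k) :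
    massOp k T (extD k (lift η)) = T η := by
  change T (contract k _) = _
  rw [contract_extD_lift]

theorem dipoleOp_lift {k : ℕ} (T : Current E k) (η : Form E k) : dipoleOp k T (lift η) = T η := by
  cases k with
  | zero => exact massOp_extD_lift T η
  | succ k =>
    change massOp (k + 1) T (extD (k + 1) (lift η)) + massOp k (bdry k T) (lift η) = _
    rw [massOp_extD_lift, massOp_lift, add_zero]

end Currents

section Seminorms

variable {ι ι' X Y X' Y' : Type*} [AddCommGroup X] [AddCommGroup Y] [AddCommGroup X']
  [AddCommGroup Y']

/-- The total size of a chain `x` modulo two that is generated by cells of given sizes: the least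
value (infimum) of `∑ vol i` over all ways of writing `x` as a finite sum of cells.  (Passing to a
common subdivision does not increase the sum, so that for a chain written as a sum of
nonoverlapping cells this is the sum of the sizes of these cells.) -/
def cellSize (cell : ι → X) (vol : ι → ℝ) (x : X) : ℝ :=
  sInf {m | ∃ s : Multiset ι, (s.map cell).sum = x ∧ m = (s.map vol).sum}

theorem cellSize_nonneg_of_mem {vol : ι → ℝ} (hvol : ∀ i, 0 ≤ vol i) (s : Multiset ι) :
    0 ≤ (s.map vol).sum :=
  Multiset.sum_nonneg fun a ha => by
    obtain ⟨i, _, rfl⟩ := Multiset.mem_map.1 ha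
    exact hvol i

theorem bddBelow_cellSize {vol : ι → ℝ} (hvol : ∀ i, 0 ≤ vol i) (cell : ι → X) (x : X) :
    BddBelow {m | ∃ s : Multiset ι, (s.map cell).sum = x ∧ m = (s.map vol).sum} := by
  refine ⟨0, ?_⟩
  rintro m ⟨s, -, rfl⟩
  exact cellSize_nonneg_of_mem hvol s

theorem cellSize_le {cell : ι → X} {vol : ι → ℝ} (hvol : ∀ i, 0 ≤ vol i) (s : Multiset ι) :
    cellSize cell vol (s.map cell).sum ≤ (s.map vol).sum :=
  csInf_le (bddBelow_cellSize hvol _ _) ⟨s, rfl, rfl⟩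

theorem exists_lt_of_cellSize {cell : ι → X} (vol : ι → ℝ)
    (hgen : ∀ x, ∃ s : Multiset ι, (s.map cell).sum = x) (x : X) {ε : ℝ} (hε : 0 < ε) :
    ∃ s : Multiset ι, (s.map cell).sum = x ∧ (s.map vol).sum < cellSize cell vol x + ε := by
  obtain ⟨s, hs⟩ := hgen x
  obtain ⟨m, ⟨t, ht, rfl⟩, hm⟩ := exists_lt_of_csInf_lt
    (s := {m | ∃ s : Multiset ι, (s.map cell).sum = x ∧ m = (s.map vol).sum}) ⟨_, s, hs, rfl⟩
    (lt_add_of_pos_right (cellSize cell vol x) hε)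
  exact ⟨t, ht, hm⟩

/-- `cellSize` as a seminorm on a group of exponent two. -/
def cellSeminorm (cell : ι → X) (vol : ι → ℝ) (hvol : ∀ i, 0 ≤ vol i)
    (hgen : ∀ x, ∃ s : Multiset ι, (s.map cell).sum = x) (hneg : ∀ x : X, -x = x) :
    AddGroupSeminorm X where
  toFun := cellSize cell vol
  map_zero' := by
    refine le_antisymm (by simpa using cellSize_le (cell := cell) hvol 0) ?_
    refine le_csInf ⟨_, 0, by simp, rfl⟩ ?_
    rintro m ⟨s, -, rfl⟩
    exact cellSize_nonneg_of_mem hvol s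
  add_le' x y := by
    refine le_of_forall_pos_le_add fun ε hε => ?_
    obtain ⟨s, rfl, h1⟩ := exists_lt_of_cellSize vol hgen x (half_pos hε)
    obtain ⟨t, rfl, h2⟩ := exists_lt_of_cellSize vol hgen y (half_pos hε)
    have := cellSize_le (cell := cell) hvol (s + t)
    simp only [Multiset.map_add, Multiset.sum_add] at this
    linarith
  neg' x := by rw [hneg]

theorem cellSeminorm_apply {cell : ι → X} {vol : ι → ℝ} {hvol : ∀ i, 0 ≤ vol i}
    {hgen : ∀ x, ∃ s : Multiset ι, (s.map cell).sum = x} {hneg : ∀ x : X, -x = x} (x : X) :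
    cellSeminorm cell vol hvol hgen hneg x = cellSize cell vol x := rfl

theorem cellSize_map_le {cell : ι → X} {vol : ι → ℝ} {cell' : ι' → Y} {vol' : ι' → ℝ}
    (hvol' : ∀ i, 0 ≤ vol' i) (hgen : ∀ x, ∃ s : Multiset ι, (s.map cell).sum = x)
    (f : X →+ Y) (g : ι → ι') (hf : ∀ i, f (cell i) = cell' (g i)) (hg : ∀ i, vol' (g i) = vol i)
    (x : X) : cellSize cell' vol' (f x) ≤ cellSize cell vol x := by
  refine le_of_forall_pos_le_add fun ε hε => ?_
  obtain ⟨s, rfl, h1⟩ := exists_lt_of_cellSize vol hgen x hε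
  refine le_trans ?_ h1.le
  have := cellSize_le (cell := cell') hvol' (s.map g)
  simpa [map_multiset_sum, Multiset.map_map, Function.comp_def, hf, hg] using this

/-- The flat seminorm `|x| = inf {p a + q b : x = a + ∂b}`. -/
def flatSeminorm (p : AddGroupSeminorm X) (q : AddGroupSeminorm Y) (d : Y →+ X) :
    AddGroupSeminorm X where
  toFun x := sInf {m | ∃ a b, x = a + d b ∧ m = p a + q b}
  map_zero' := by
    refine le_antisymm (csInf_le ⟨0, ?_⟩ ⟨0, 0, by simp, by simp⟩)
      (le_csInf ⟨_, 0, 0, by simp, rfl⟩ ?_)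
    all_goals
      rintro m ⟨a, b, -, rfl⟩
      exact add_nonneg (apply_nonneg p a) (apply_nonneg q b)
  add_le' x y := by
    have hb : ∀ x, BddBelow {m | ∃ a b, x = a + d b ∧ m = p a + q b} := by
      intro x
      refine ⟨0, ?_⟩
      rintro m ⟨a, b, -, rfl⟩
      exact add_nonneg (apply_nonneg p a) (apply_nonneg q b)
    have hn : ∀ x, {m | ∃ a b, x = a + d b ∧ m = p a + q b}.Nonempty :=
      fun x => ⟨_, x, 0, by simp, rfl⟩
    refine le_of_forall_pos_le_add fun ε hε => ?_
    obtain ⟨_, ⟨a, b, h1, rfl⟩, h2⟩ :=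
      exists_lt_of_csInf_lt (hn x) (lt_add_of_pos_right _ (half_pos hε))
    obtain ⟨_, ⟨a', b', h1', rfl⟩, h2'⟩ :=
      exists_lt_of_csInf_lt (hn y) (lt_add_of_pos_right _ (half_pos hε))
    have h3 := csInf_le (hb (x + y)) ⟨a + a', b + b', by rw [h1, h1', map_add]; abel, rfl⟩
    linarith [map_add_le_add p a a', map_add_le_add q b b']
  neg' x := by
    congr 1
    ext m
    constructor
    · rintro ⟨a, b, h1, rfl⟩
      exact ⟨-a, -b, by rw [map_neg, ← neg_add, ← h1, neg_neg], by simp⟩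
    · rintro ⟨a, b, h1, rfl⟩
      exact ⟨-a, -b, by rw [map_neg, ← neg_add, ← h1], by simp⟩

theorem flatSeminorm_apply (p : AddGroupSeminorm X) (q : AddGroupSeminorm Y) (d : Y →+ X) (x : X) :
    flatSeminorm p q d x = sInf {m | ∃ a b, x = a + d b ∧ m = p a + q b} := rfl

theorem flatSeminorm_le (p : AddGroupSeminorm X) (q : AddGroupSeminorm Y) (d : Y →+ X) (a : X)
    (b : Y) : flatSeminorm p q d (a + d b) ≤ p a + q b := by
  refine csInf_le ⟨0, ?_⟩ ⟨a, b, rfl, rfl⟩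
  rintro m ⟨a, b, -, rfl⟩
  exact add_nonneg (apply_nonneg p a) (apply_nonneg q b)

theorem le_flatSeminorm (p : AddGroupSeminorm X) (q : AddGroupSeminorm Y) (d : Y →+ X) (x : X)
    (c : ℝ) (h : ∀ a b, x = a + d b → c ≤ p a + q b) : c ≤ flatSeminorm p q d x := by
  refine le_csInf ⟨_, x, 0, by simp, rfl⟩ ?_
  rintro m ⟨a, b, h1, rfl⟩
  exact h a b h1

end Seminorms

section Mod2

variable {X ι : Type*} [AddCommGroup X]

theorem neg_eq_self_mod2 {P : Submodule ℤ X} (x : P ⊗[ℤ] ZMod 2) : -x = x := by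
  have h : (2 : ℤ) • x = 0 := by
    induction x using TensorProduct.induction_on with
    | zero => simp
    | tmul p c =>
      rw [TensorProduct.smul_tmul', TensorProduct.smul_tmul]
      have : (2 : ℤ) • c = 0 := by revert c; decide
      rw [this, TensorProduct.tmul_zero]
    | add x y hx hy => rw [smul_add, hx, hy, add_zero]
  rw [neg_eq_iff_add_eq_zero, ← two_zsmul]
  exact h

theorem exists_multiset_mod2 {c : ι → X} {P : Submodule ℤ X} (hP : P = Submodule.span ℤ (Set.range c))
    (cell : ι → P) (hcell : ∀ i, (cell i : X) = c i) (x : P ⊗[ℤ] ZMod 2) :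
    ∃ s : Multiset ι, (s.map fun i => cell i ⊗ₜ[ℤ] (1 : ZMod 2)).sum = x := by
  induction x using TensorProduct.induction_on with
  | zero => exact ⟨0, by simp⟩
  | add x y hx hy =>
    obtain ⟨s, rfl⟩ := hx
    obtain ⟨t, rfl⟩ := hy
    exact ⟨s + t, by simp⟩
  | tmul p e =>
    obtain ⟨p, hp⟩ := p
    have hp' : p ∈ Submodule.span ℤ (Set.range c) := hP ▸ hp
    suffices H : ∀ (p : X) (_ : p ∈ Submodule.span ℤ (Set.range c)) (hp : p ∈ P) (e : ZMod 2),
        ∃ s : Multiset ι, (s.map fun i => cell i ⊗ₜ[ℤ] (1 : ZMod 2)).sum =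
          (⟨p, hp⟩ : P) ⊗ₜ[ℤ] e from H p hp' hp e
    intro p hp'
    induction hp' using Submodule.span_induction with
    | mem x h =>
      obtain ⟨i, rfl⟩ := h
      intro hp e
      have e1 : (⟨c i, hp⟩ : P) = cell i := Subtype.ext (hcell i).symm
      rw [e1]
      obtain rfl | rfl : e = 0 ∨ e = 1 := by revert e; decide
      · exact ⟨0, by simp⟩
      · exact ⟨{i}, by simp⟩
    | zero =>
      intro hp e
      refine ⟨0, ?_⟩
      have : (⟨0, hp⟩ : P) = 0 := rfl
      rw [this]
      simp
    | add x y hx hy ihx ihy =>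
      intro hp e
      have hx' : x ∈ P := hP ▸ hx
      have hy' : y ∈ P := hP ▸ hy
      obtain ⟨s, hs⟩ := ihx hx' e
      obtain ⟨t, ht⟩ := ihy hy' e
      refine ⟨s + t, ?_⟩
      have : (⟨x + y, hp⟩ : P) = ⟨x, hx'⟩ + ⟨y, hy'⟩ := rfl
      rw [this, TensorProduct.add_tmul, ← hs, ← ht]
      simp
    | smul a x hx ihx =>
      intro hp e
      have hx' : x ∈ P := hP ▸ hx
      obtain ⟨s, hs⟩ := ihx hx' (a • e)
      refine ⟨s, ?_⟩
      have : (⟨a • x, hp⟩ : P) = a • ⟨x, hx'⟩ := rfl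
      rw [this, TensorProduct.smul_tmul, hs]

end Mod2

section Chains

variable {E : Type*} [NormedAddCommGroup E] [InnerProductSpace ℝ E]

/-- The `k`-dimensional volume `M(σ) = √det(⟨e_i, e_j⟩) / k!` of a `k`-simplex with edge vectors
`e_i`. -/
def Simplex.vol {k : ℕ} (σ : Simplex E k) : ℝ := √(Matrix.gram ℝ σ.edge).det / k.factorial

theorem Simplex.vol_nonneg {k : ℕ} (σ : Simplex E k) : 0 ≤ σ.vol := by
  unfold Simplex.vol; positivity

/-! ### Polyhedral chains -/

variable (E) in
/-- The group `P_k(ℤ)` of integral polyhedral `k`-chains: finite sums of oriented simplices, two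
sums being identified if they define the same current. -/
def IntChain (k : ℕ) : Submodule ℤ (Current E k) :=
  Submodule.span ℤ (Set.range fun σ : Simplex E k => simplexCurrent σ)

theorem bdry_mem_intChain {k : ℕ} (T : Current E (k + 1)) (hT : T ∈ IntChain E (k + 1)) :
    bdry k T ∈ IntChain E k := by
  induction hT using Submodule.span_induction with
  | mem x h =>
    obtain ⟨σ, rfl⟩ := h
    simp only [bdry_simplexCurrent]
    exact Submodule.sum_mem _ fun i _ =>
      Submodule.smul_mem _ _ (Submodule.subset_span ⟨σ.face i, rfl⟩)
  | zero => rw [map_zero]; exact Submodule.zero_mem _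
  | add x y _ _ hx hy => rw [map_add]; exact Submodule.add_mem _ hx hy
  | smul a x _ hx => rw [map_zsmul]; exact Submodule.smul_mem _ _ hx

/-- Restriction of an additive map to subgroups (as `ℤ`-submodules), tensored with `ℤ/2`. -/
def mod2Map {X Y : Type*} [AddCommGroup X] [AddCommGroup Y] (f : X →+ Y) (P : Submodule ℤ X)
    (Q : Submodule ℤ Y) (h : ∀ x ∈ P, f x ∈ Q) : P ⊗[ℤ] ZMod 2 →+ Q ⊗[ℤ] ZMod 2 :=
  (LinearMap.rTensor (ZMod 2) (f.toIntLinearMap.restrict h)).toAddMonoidHom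

theorem mod2Map_tmul {X Y : Type*} [AddCommGroup X] [AddCommGroup Y] (f : X →+ Y)
    (P : Submodule ℤ X) (Q : Submodule ℤ Y) (h : ∀ x ∈ P, f x ∈ Q) (x : P) (e : ZMod 2) :
    mod2Map f P Q h (x ⊗ₜ[ℤ] e) = (⟨f x, h x x.2⟩ : Q) ⊗ₜ[ℤ] e := rfl

variable (E) in
/-- Polyhedral `k`-chains modulo two, `P_k(ℤ₂) = P_k(ℤ) ⊗ ℤ₂`. -/
def PolyChain (k : ℕ) : Type _ := IntChain E k ⊗[ℤ] ZMod 2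

instance (k : ℕ) : AddCommGroup (PolyChain E k) :=
  inferInstanceAs (AddCommGroup (IntChain E k ⊗[ℤ] ZMod 2))

/-- The polyhedral chain modulo two of a single simplex. -/
def polyCell {k : ℕ} (σ : Simplex E k) : PolyChain E k :=
  (⟨simplexCurrent σ, Submodule.subset_span ⟨σ, rfl⟩⟩ : IntChain E k) ⊗ₜ[ℤ] (1 : ZMod 2)

/-- The boundary of polyhedral chains modulo two. -/
def polyBdry (k : ℕ) : PolyChain E (k + 1) →+ PolyChain E k :=
  mod2Map (bdry k).toAddMonoidHom (IntChain E (k + 1)) (IntChain E k) bdry_mem_intChain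

theorem exists_polyCell_sum {k : ℕ} (P : PolyChain E k) :
    ∃ s : Multiset (Simplex E k), (s.map polyCell).sum = P :=
  exists_multiset_mod2 rfl _ (fun _ => rfl) P

theorem PolyChain.neg_eq {k : ℕ} (P : PolyChain E k) : -P = P := neg_eq_self_mod2 P

/-- The mass `M(P)` of a polyhedral chain modulo two: the total volume of the cells of `P`. -/
def polyMass (k : ℕ) : AddGroupSeminorm (PolyChain E k) :=
  cellSeminorm polyCell Simplex.vol Simplex.vol_nonneg exists_polyCell_sum PolyChain.neg_eq

/-- The flat norm `M_♭(P) = inf {M(Q) + M(R) : P = Q + ∂R}` on polyhedral chains modulo two. -/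
def polyFlatNorm (k : ℕ) : AddGroupSeminorm (PolyChain E k) :=
  flatSeminorm (polyMass k) (polyMass (k + 1)) (polyBdry k)

instance (k : ℕ) : SeminormedAddCommGroup (PolyChain E k) :=
  (polyFlatNorm k).toSeminormedAddCommGroup

theorem PolyChain.norm_def {k : ℕ} (P : PolyChain E k) : ‖P‖ = polyFlatNorm k P := rfl

variable (E) in
/-- Flat `k`-chains modulo two: the completion of the polyhedral chains in the flat norm. -/
abbrev FlatChain (k : ℕ) : Type _ := UniformSpace.Completion (PolyChain E k)

/-- The mass of a flat chain: the lower semicontinuous extension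
`M(B) = inf {lim inf M(P_i) : P_i polyhedral, P_i → B in the flat norm}`. -/
def flatMass {k : ℕ} (B : FlatChain E k) : ENNReal :=
  ⨅ (P : ℕ → PolyChain E k) (_ : Tendsto (fun i => (P i : FlatChain E k)) atTop (𝓝 B)),
    liminf (fun i => ENNReal.ofReal (polyMass k (P i))) atTop

/-! ### Dipolyhedra -/

variable (E) in
/-- The simplices whose mass cells are `k`-dimensional: those of dimension `k - 1`, and none if
`k = 0`. -/
def MassIndex : ℕ → Type _
  | 0 => PEmpty
  | k + 1 => Simplex E k

/-- The mass cell `μσ` of a `(k-1)`-simplex `σ`, a `k`-dimensional current in `E × ℝ`. -/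
def massCell : (k : ℕ) → MassIndex E k → Current (E × ℝ) k
  | 0 => PEmpty.elim
  | k + 1 => fun σ => massOp k (simplexCurrent (σ : Simplex E k))

/-- The mass `M(μσ) = M(σ)` of a mass cell. -/
def massCellVol : (k : ℕ) → MassIndex E k → ℝ
  | 0 => PEmpty.elim
  | _ + 1 => Simplex.vol

theorem massCellVol_nonneg : (k : ℕ) → (σ : MassIndex E k) → 0 ≤ massCellVol k σ
  | 0 => fun σ => PEmpty.elim σ
  | _ + 1 => Simplex.vol_nonneg

/-- The dipole cell `δσ = ∂μσ + μ∂σ` of a `k`-simplex `σ`, a `k`-dimensional current in `E × ℝ`. -/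
def dipoleCell (k : ℕ) (σ : Simplex E k) : Current (E × ℝ) k := dipoleOp k (simplexCurrent σ)

variable (E) in
/-- The group `S_k(ℤ)` of integral dipole chains. -/
def IntDipoleChain (k : ℕ) : Submodule ℤ (Current (E × ℝ) k) :=
  Submodule.span ℤ (Set.range (dipoleCell k : Simplex E k → _))

variable (E) in
/-- The group `T_k(ℤ)` of integral mass chains. -/
def IntMassChain (k : ℕ) : Submodule ℤ (Current (E × ℝ) k) :=
  Submodule.span ℤ (Set.range (massCell k : MassIndex E k → _))

variable (E) in
/-- The group `D_k(ℤ) = S_k(ℤ) ⊕ T_k(ℤ)` of integral dipolyhedra.  The sum is direct by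
`disjoint_dipole_mass`. -/
def IntDipolyhedron (k : ℕ) : Submodule ℤ (Current (E × ℝ) k) :=
  IntDipoleChain E k ⊔ IntMassChain E k

theorem dipoleOp_mem {k : ℕ} (T : Current E k) (hT : T ∈ IntChain E k) :
    dipoleOp k T ∈ IntDipoleChain E k := by
  induction hT using Submodule.span_induction with
  | mem x h => obtain ⟨σ, rfl⟩ := h; exact Submodule.subset_span ⟨σ, rfl⟩
  | zero => rw [map_zero]; exact Submodule.zero_mem _
  | add x y _ _ hx hy => rw [map_add]; exact Submodule.add_mem _ hx hy
  | smul a x _ hx => rw [map_zsmul]; exact Submodule.smul_mem _ _ hx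

theorem massOp_mem {k : ℕ} (T : Current E k) (hT : T ∈ IntChain E k) :
    massOp k T ∈ IntMassChain E (k + 1) := by
  induction hT using Submodule.span_induction with
  | mem x h => obtain ⟨σ, rfl⟩ := h; exact Submodule.subset_span ⟨σ, rfl⟩
  | zero => rw [map_zero]; exact Submodule.zero_mem _
  | add x y _ _ hx hy => rw [map_add]; exact Submodule.add_mem _ hx hy
  | smul a x _ hx => rw [map_zsmul]; exact Submodule.smul_mem _ _ hx

theorem exists_of_mem_intDipoleChain {k : ℕ} {S : Current (E × ℝ) k} (hS : S ∈ IntDipoleChain E k) :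
    ∃ B ∈ IntChain E k, S = dipoleOp k B := by
  induction hS using Submodule.span_induction with
  | mem x h => obtain ⟨σ, rfl⟩ := h; exact ⟨_, Submodule.subset_span ⟨σ, rfl⟩, rfl⟩
  | zero => exact ⟨0, Submodule.zero_mem _, (map_zero _).symm⟩
  | add x y _ _ hx hy =>
    obtain ⟨B, hB, rfl⟩ := hx
    obtain ⟨B', hB', rfl⟩ := hy
    exact ⟨B + B', Submodule.add_mem _ hB hB', (map_add _ _ _).symm⟩
  | smul a x _ hx =>
    obtain ⟨B, hB, rfl⟩ := hx
    exact ⟨a • B, Submodule.smul_mem _ _ hB, (map_zsmul _ _ _).symm⟩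

theorem exists_of_mem_intMassChain {k : ℕ} {T : Current (E × ℝ) (k + 1)}
    (hT : T ∈ IntMassChain E (k + 1)) : ∃ C ∈ IntChain E k, T = massOp k C := by
  induction hT using Submodule.span_induction with
  | mem x h => obtain ⟨σ, rfl⟩ := h; exact ⟨_, Submodule.subset_span ⟨σ, rfl⟩, rfl⟩
  | zero => exact ⟨0, Submodule.zero_mem _, (map_zero _).symm⟩
  | add x y _ _ hx hy =>
    obtain ⟨B, hB, rfl⟩ := hx
    obtain ⟨B', hB', rfl⟩ := hy
    exact ⟨B + B', Submodule.add_mem _ hB hB', (map_add _ _ _).symm⟩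
  | smul a x _ hx =>
    obtain ⟨B, hB, rfl⟩ := hx
    exact ⟨a • B, Submodule.smul_mem _ _ hB, (map_zsmul _ _ _).symm⟩

theorem intMassChain_zero : IntMassChain E 0 = ⊥ := by
  rw [IntMassChain, Submodule.span_eq_bot]
  rintro x ⟨σ, -⟩
  exact PEmpty.elim σ

/-- Dipole chains and mass chains meet only in zero. -/
theorem disjoint_dipole_mass (k : ℕ) : Disjoint (IntDipoleChain E k) (IntMassChain E k) := by
  rw [Submodule.disjoint_def]
  intro x hS hT
  cases k with
  | zero => rwa [intMassChain_zero, Submodule.mem_bot] at hT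
  | succ k =>
    obtain ⟨B, -, rfl⟩ := exists_of_mem_intDipoleChain hS
    obtain ⟨C, -, h⟩ := exists_of_mem_intMassChain hT
    have : B = 0 := by
      ext η
      have := LinearMap.congr_fun h (lift η)
      rwa [dipoleOp_lift, massOp_lift] at this
    rw [this, map_zero]

theorem dipoleOp_mem' {k : ℕ} (T : Current E k) (hT : T ∈ IntChain E k) :
    dipoleOp k T ∈ IntDipolyhedron E k :=
  Submodule.mem_sup_left (dipoleOp_mem T hT)

theorem massOp_mem' {k : ℕ} (T : Current E k) (hT : T ∈ IntChain E k) :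
    massOp k T ∈ IntDipolyhedron E (k + 1) :=
  Submodule.mem_sup_right (massOp_mem T hT)

theorem bdry_mem_intDipolyhedron {k : ℕ} (D : Current (E × ℝ) (k + 1))
    (hD : D ∈ IntDipolyhedron E (k + 1)) : bdry k D ∈ IntDipolyhedron E k := by
  obtain ⟨S, hS, T, hT, rfl⟩ := Submodule.mem_sup.1 hD
  obtain ⟨B, hB, rfl⟩ := exists_of_mem_intDipoleChain hS
  obtain ⟨C, hC, rfl⟩ := exists_of_mem_intMassChain hT
  rw [map_add, bdry_dipoleOp]
  refine Submodule.add_mem _ (dipoleOp_mem' _ (bdry_mem_intChain _ hB)) ?_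
  cases k with
  | zero => exact dipoleOp_mem' _ hC
  | succ k =>
    rw [bdry_massOp]
    exact Submodule.sub_mem _ (dipoleOp_mem' _ hC) (massOp_mem' _ (bdry_mem_intChain _ hC))

variable (E) in
/-- `k`-dipolyhedra modulo two, `D_k(ℤ₂) = D_k(ℤ) ⊗ ℤ₂ = (S_k(ℤ) ⊗ ℤ₂) ⊕ (T_k(ℤ) ⊗ ℤ₂)`. -/
def Dipolyhedron (k : ℕ) : Type _ := IntDipolyhedron E k ⊗[ℤ] ZMod 2

instance (k : ℕ) : AddCommGroup (Dipolyhedron E k) :=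
  inferInstanceAs (AddCommGroup (IntDipolyhedron E k ⊗[ℤ] ZMod 2))

/-- The boundary of dipolyhedra modulo two. -/
def dipBdry (k : ℕ) : Dipolyhedron E (k + 1) →+ Dipolyhedron E k :=
  mod2Map (bdry k).toAddMonoidHom (IntDipolyhedron E (k + 1)) (IntDipolyhedron E k)
    bdry_mem_intDipolyhedron

/-- The cells of dipolyhedra: dipole cells and mass cells. -/
def dipCell (k : ℕ) : Simplex E k ⊕ MassIndex E k → IntDipolyhedron E k
  | .inl σ => ⟨dipoleCell k σ, Submodule.mem_sup_left (Submodule.subset_span ⟨σ, rfl⟩)⟩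
  | .inr σ => ⟨massCell k σ, Submodule.mem_sup_right (Submodule.subset_span ⟨σ, rfl⟩)⟩

/-- The cells of dipolyhedra modulo two. -/
def dipCell2 (k : ℕ) (c : Simplex E k ⊕ MassIndex E k) : Dipolyhedron E k :=
  dipCell k c ⊗ₜ[ℤ] (1 : ZMod 2)

/-- The weight of a dipole cell `δσ` and the mass of a mass cell `μσ`, both equal to the volume of
`σ`. -/
def dipCellVol (k : ℕ) : Simplex E k ⊕ MassIndex E k → ℝ :=
  Sum.elim Simplex.vol (massCellVol k)

theorem dipCellVol_nonneg {k : ℕ} (c : Simplex E k ⊕ MassIndex E k) : 0 ≤ dipCellVol k c := by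
  cases c with
  | inl σ => exact Simplex.vol_nonneg σ
  | inr σ => exact massCellVol_nonneg k σ

theorem exists_dipCell_sum {k : ℕ} (D : Dipolyhedron E k) :
    ∃ s : Multiset (Simplex E k ⊕ MassIndex E k), (s.map (dipCell2 k)).sum = D := by
  refine exists_multiset_mod2 (c := Sum.elim (dipoleCell k) (massCell k)) ?_ (dipCell k) ?_ D
  · rw [IntDipolyhedron, IntDipoleChain, IntMassChain, ← Submodule.span_union, Set.Sum.elim_range]
  · rintro (σ | σ) <;> rfl

theorem Dipolyhedron.neg_eq {k : ℕ} (D : Dipolyhedron E k) : -D = D := neg_eq_self_mod2 D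

/-- The energy of a dipolyhedron `D = S + T`, the weight `W(S)` plus the mass `M(T)`: the total
volume of its dipole cells and its mass cells. -/
def energy (k : ℕ) : AddGroupSeminorm (Dipolyhedron E k) :=
  cellSeminorm (dipCell2 k) (dipCellVol k) dipCellVol_nonneg exists_dipCell_sum Dipolyhedron.neg_eq

/-- The norm `E_♭(D) = inf {E(Q) + E(R) : D = Q + ∂R}` on dipolyhedra modulo two. -/
def energyFlatNorm (k : ℕ) : AddGroupSeminorm (Dipolyhedron E k) :=
  flatSeminorm (energy k) (energy (k + 1)) (dipBdry k)

instance (k : ℕ) : SeminormedAddCommGroup (Dipolyhedron E k) :=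
  (energyFlatNorm k).toSeminormedAddCommGroup

theorem Dipolyhedron.norm_def {k : ℕ} (D : Dipolyhedron E k) : ‖D‖ = energyFlatNorm k D := rfl

variable (E) in
/-- Flat `k`-dipolyhedra modulo two: the completion of the dipolyhedra in the norm `E_♭`. -/
abbrev FlatDipolyhedron (k : ℕ) : Type _ := UniformSpace.Completion (Dipolyhedron E k)

/-- The energy of a flat dipolyhedron: the lower semicontinuous extension
`E(A) = inf {lim inf E(D_i) : D_i dipolyhedra, D_i → A in the norm E_♭}`. -/
def flatEnergy {k : ℕ} (A : FlatDipolyhedron E k) : ENNReal :=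
  ⨅ (D : ℕ → Dipolyhedron E k)
    (_ : Tendsto (fun i => (D i : FlatDipolyhedron E k)) atTop (𝓝 A)),
    liminf (fun i => ENNReal.ofReal (energy k (D i))) atTop

/-! ### The operators `δ` and `μ` -/

/-- `δ` on polyhedral chains modulo two. -/
def polyDelta (k : ℕ) : PolyChain E k →+ Dipolyhedron E k :=
  mod2Map (dipoleOp k).toAddMonoidHom (IntChain E k) (IntDipolyhedron E k) dipoleOp_mem'

/-- `μ` on polyhedral chains modulo two. -/
def polyMu (k : ℕ) : PolyChain E k →+ Dipolyhedron E (k + 1) :=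
  mod2Map (massOp k).toAddMonoidHom (IntChain E k) (IntDipolyhedron E (k + 1)) massOp_mem'

theorem mod2_hom_ext {X Y : Type*} [AddCommGroup X] [AddCommGroup Y] {P : Submodule ℤ X}
    {f g : P ⊗[ℤ] ZMod 2 →+ Y} (h : ∀ (p : P) (e : ZMod 2), f (p ⊗ₜ[ℤ] e) = g (p ⊗ₜ[ℤ] e)) :
    f = g := by
  ext x
  induction x using TensorProduct.induction_on with
  | zero => simp
  | tmul p e => exact h p e
  | add x y hx hy => rw [map_add, map_add, hx, hy]

theorem dipBdry_polyDelta {k : ℕ} (P : PolyChain E (k + 1)) :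
    dipBdry k (polyDelta (k + 1) P) = polyDelta k (polyBdry k P) := by
  have : (dipBdry k).comp (polyDelta (k + 1)) =
      ((polyDelta k).comp (polyBdry k) : PolyChain E (k + 1) →+ Dipolyhedron E k) := by
    refine mod2_hom_ext fun p e => ?_
    have e1 : (⟨bdry k (dipoleOp (k + 1) p.1), bdry_mem_intDipolyhedron _ (dipoleOp_mem' _ p.2)⟩ :
        IntDipolyhedron E k) = ⟨dipoleOp k (bdry k p.1), dipoleOp_mem' _ (bdry_mem_intChain _ p.2)⟩ :=
      Subtype.ext (bdry_dipoleOp p.1)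
    exact congrArg (· ⊗ₜ[ℤ] e) e1
  exact DFunLike.congr_fun this P

theorem dipBdry_polyMu_zero (P : PolyChain E 0) : dipBdry 0 (polyMu 0 P) = polyDelta 0 P := by
  have : (dipBdry 0).comp (polyMu 0) = (polyDelta 0 : PolyChain E 0 →+ Dipolyhedron E 0) :=
    mod2_hom_ext fun p e => rfl
  exact DFunLike.congr_fun this P

theorem dipBdry_polyMu {k : ℕ} (P : PolyChain E (k + 1)) :
    dipBdry (k + 1) (polyMu (k + 1) P) = polyDelta (k + 1) P - polyMu k (polyBdry k P) := by
  have : (dipBdry (k + 1)).comp (polyMu (k + 1)) =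
      (polyDelta (k + 1) - (polyMu k).comp (polyBdry k) :
        PolyChain E (k + 1) →+ Dipolyhedron E (k + 1)) := by
    refine mod2_hom_ext fun p e => ?_
    have e1 : (⟨bdry (k + 1) (massOp (k + 1) p.1),
        bdry_mem_intDipolyhedron _ (massOp_mem' _ p.2)⟩ : IntDipolyhedron E (k + 1)) =
        ⟨dipoleOp (k + 1) p.1, dipoleOp_mem' _ p.2⟩ -
          ⟨massOp k (bdry k p.1), massOp_mem' _ (bdry_mem_intChain _ p.2)⟩ :=
      Subtype.ext (bdry_massOp p.1)
    exact (congrArg (· ⊗ₜ[ℤ] e) e1).trans (TensorProduct.sub_tmul _ _ _)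
  exact DFunLike.congr_fun this P

theorem energy_polyDelta_le {k : ℕ} (P : PolyChain E k) :
    energy k (polyDelta k P) ≤ polyMass k P :=
  cellSize_map_le dipCellVol_nonneg exists_polyCell_sum (polyDelta k) Sum.inl
    (fun _ => rfl) (fun _ => rfl) P

theorem energy_polyMu_le {k : ℕ} (P : PolyChain E k) :
    energy (k + 1) (polyMu k P) ≤ polyMass k P :=
  cellSize_map_le dipCellVol_nonneg exists_polyCell_sum (polyMu k)
    (fun σ => (Sum.inr σ : Simplex E (k + 1) ⊕ MassIndex E (k + 1)))
    (fun _ => rfl) (fun _ => rfl) P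

theorem norm_polyDelta_le {k : ℕ} (P : PolyChain E k) : ‖polyDelta k P‖ ≤ 1 * ‖P‖ := by
  rw [one_mul, PolyChain.norm_def, Dipolyhedron.norm_def]
  refine le_flatSeminorm _ _ _ _ _ fun Q R h => ?_
  rw [h, map_add, ← dipBdry_polyDelta]
  exact (flatSeminorm_le _ _ _ _ _).trans
    (add_le_add (energy_polyDelta_le Q) (energy_polyDelta_le R))

theorem norm_polyMu_le {k : ℕ} (P : PolyChain E k) : ‖polyMu k P‖ ≤ 2 * ‖P‖ := by
  suffices H : energyFlatNorm (k + 1) (polyMu k P) / 2 ≤ polyFlatNorm k P by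
    rw [PolyChain.norm_def, Dipolyhedron.norm_def]; linarith
  refine le_flatSeminorm _ _ _ _ _ fun Q R h => ?_
  have e : polyMu k P = (polyMu k Q + polyDelta (k + 1) R) + dipBdry (k + 1) (polyMu (k + 1) R) := by
    rw [dipBdry_polyMu, h, map_add]
    have := Dipolyhedron.neg_eq (polyDelta (k + 1) R)
    have h2 := Dipolyhedron.neg_eq (polyMu k (polyBdry k R))
    rw [sub_eq_add_neg, h2]
    nth_rewrite 1 [← this]
    abel
  rw [e]
  have h1 : energyFlatNorm (k + 1)
      (polyMu k Q + polyDelta (k + 1) R + dipBdry (k + 1) (polyMu (k + 1) R)) ≤ _ :=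
    flatSeminorm_le _ _ _ _ _
  linarith [map_add_le_add (energy (k + 1)) (polyMu k Q) (polyDelta (k + 1) R),
    energy_polyMu_le Q, energy_polyMu_le R, energy_polyDelta_le R, apply_nonneg (polyMass k) Q]

/-- The operator `δ` from flat `k`-chains to flat `k`-dipolyhedra: the continuous extension of `δ`
from polyhedral chains. -/
def delta (k : ℕ) : NormedAddGroupHom (FlatChain E k) (FlatDipolyhedron E k) :=
  (AddMonoidHom.mkNormedAddGroupHom (polyDelta k) 1 norm_polyDelta_le).completion

/-- The operator `μ` from flat `k`-chains to flat `(k+1)`-dipolyhedra: the continuous extension of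
`μ` from polyhedral chains. -/
def mu (k : ℕ) : NormedAddGroupHom (FlatChain E k) (FlatDipolyhedron E (k + 1)) :=
  (AddMonoidHom.mkNormedAddGroupHom (polyMu k) 2 norm_polyMu_le).completion

end Chains

end Dipole

end

/-!
# Flat dipolyhedra as pairs of flat chains

A dipolyhedron of dimension `k + 1` is `δB + μC` for exactly one pair of polyhedral chains, and the
content of the theorem is that this algebraic splitting is bounded in both directions, so that
it survives completion.

The chain `B` is recovered by testing a current against the forms `s · η`, where `s` is the last
coordinate of `E × ℝ`: this inverts `δ` and kills `μ` (`dipolePart`).  The chain `C` is recovered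
from the boundary: since `∂(δB + μC) = δ(∂B + C) - μ∂C`, it is the dipole part of the boundary less
`∂B` (`massPart`).  Dipole cells and mass cells are sent to cells of the same volume, so the energy
is `E(δB + μC) = M(B) + M(C)` (`energy_eq_add`).  Applied to the two terms of a decomposition
`D = Q + ∂R`, the same boundary formula exhibits `B` and `C` as admissible in the flat norm:
`B = (Q_B + R_C) + ∂R_B` and, modulo two, `C = Q_C + ∂R_C`.  Hence both parts are
norm-nonincreasing (`norm_dipolePart_le`, `norm_massPart_le`) and extend to the completions, where
they are the inverse of `(B, C) ↦ δB + μC`.  Existence, uniqueness and the convergence of `B_i` and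
`C_i` follow from continuity alone.

The mass and the energy of flat objects are lower semicontinuous extensions.  Superadditivity of
the lower limit gives `M(B) + M(C) ≤ E(A)`, and approximating `B` and `C` separately gives the
reverse inequality (`flatEnergy_eq_add`).  If `M(B_i) + M(C_i)` converges to the finite sum
`M(B) + M(C)` while each mass is lower semicontinuous, neither mass can exceed its limit, so both
converge (`tendsto_of_tendsto_add`).
-/

namespace Dipole

/-! ### Relaxation of a functional to the completion -/

section Relaxation

variable {X : Type*} [SeminormedAddCommGroup X]

/-- The lower semicontinuous extension of `f` to the completion of `X`.  For `f` the mass of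
polyhedral chains or the energy of dipolyhedra it is, by definition, `flatMass` or `flatEnergy`. -/
noncomputable def relax (f : X → ENNReal) (A : UniformSpace.Completion X) : ENNReal :=
  ⨅ (x : ℕ → X) (_ : Tendsto (fun i => (x i : UniformSpace.Completion X)) atTop (𝓝 A)),
    liminf (fun i => f (x i)) atTop

variable {f : X → ENNReal} {A : UniformSpace.Completion X} {c : ENNReal}

theorem relax_le_liminf {x : ℕ → X}
    (hx : Tendsto (fun i => (x i : UniformSpace.Completion X)) atTop (𝓝 A)) :
    relax f A ≤ liminf (fun i => f (x i)) atTop :=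
  iInf₂_le x hx

theorem exists_lt_of_relax_lt (h : relax f A < c) {U : Set (UniformSpace.Completion X)}
    (hU : U ∈ 𝓝 A) : ∃ x : X, (x : UniformSpace.Completion X) ∈ U ∧ f x < c := by
  obtain ⟨x, hx⟩ := iInf_lt_iff.1 h
  obtain ⟨hxA, hlt⟩ := iInf_lt_iff.1 hx
  obtain ⟨i, hi, hiU⟩ := ((frequently_lt_of_liminf_lt (by isBoundedDefault) hlt).and_eventually
    (hxA hU)).exists
  exact ⟨x i, hiU, hi⟩

theorem relax_le_of_forall_nhds
    (h : ∀ U ∈ 𝓝 A, ∃ x : X, (x : UniformSpace.Completion X) ∈ U ∧ f x ≤ c) : relax f A ≤ c := by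
  obtain ⟨U, hU⟩ := (𝓝 A).exists_antitone_basis
  choose x hxU hxc using fun i => h (U i) (hU.1.mem_of_mem trivial)
  refine (relax_le_liminf (hU.tendsto hxU)).trans ?_
  exact liminf_le_of_frequently_le (Frequently.of_forall hxc)

/-- Lower semicontinuity of the extension, along sequences in the completion. -/
theorem relax_le_liminf_relax {u : ℕ → UniformSpace.Completion X}
    (hu : Tendsto u atTop (𝓝 A)) : relax f A ≤ liminf (fun i => relax f (u i)) atTop := by
  refine le_of_forall_gt_imp_ge_of_dense fun c hc => relax_le_of_forall_nhds fun U hU => ?_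
  obtain ⟨i, hi, hiU⟩ := ((frequently_lt_of_liminf_lt (by isBoundedDefault) hc).and_eventually
    (hu (eventually_mem_nhds_iff.2 hU))).exists
  obtain ⟨x, hxU, hx⟩ := exists_lt_of_relax_lt hi hiU
  exact ⟨x, hxU, hx.le⟩

end Relaxation

/-! ### Lower limits of sums -/

section ENNReal

variable {ι : Type*} {l : Filter ι} {u v : ι → ENNReal} {a b : ENNReal}

theorem tendsto_min_of_le_liminf (h : a ≤ liminf u l) :
    Tendsto (fun i => min (u i) a) l (𝓝 a) := by
  refine tendsto_order.2 ⟨fun c hc => ?_, fun c hc => ?_⟩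
  · filter_upwards [eventually_lt_of_lt_liminf (hc.trans_le h)] with i hi using lt_min hi hc
  · exact Eventually.of_forall fun i => (min_le_right _ _).trans_lt hc

theorem add_le_liminf_add [l.NeBot] (ha : a ≤ liminf u l) (hb : b ≤ liminf v l) :
    a + b ≤ liminf (fun i => u i + v i) l := by
  rw [← ((tendsto_min_of_le_liminf ha).add (tendsto_min_of_le_liminf hb)).liminf_eq]
  exact liminf_le_liminf (Eventually.of_forall fun i =>
    add_le_add (min_le_left _ _) (min_le_left _ _))

theorem tendsto_left_of_tendsto_add [l.NeBot] (ha : a ≤ liminf u l) (hb : b ≤ liminf v l)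
    (h : Tendsto (fun i => u i + v i) l (𝓝 (a + b))) (hab : a + b ≠ ⊤) : Tendsto u l (𝓝 a) := by
  have hb' : b ≠ ⊤ := (ENNReal.add_ne_top.1 hab).2
  refine tendsto_of_le_liminf_of_limsup_le ha ?_
  -- `u ≤ (u + v) - min v b`, and truncating `v` at `b` makes the right side convergent
  have h1 := ENNReal.Tendsto.sub h (tendsto_min_of_le_liminf hb) (Or.inl hab)
  rw [ENNReal.add_sub_cancel_right hb'] at h1
  rw [← h1.limsup_eq]
  refine limsup_le_limsup (Eventually.of_forall fun i => ?_)
  refine ENNReal.le_sub_of_add_le_right ((min_le_right _ _).trans_lt hb'.lt_top).ne ?_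
  exact add_le_add le_rfl (min_le_left _ _)

/-- If a sum converges to a finite sum of lower bounds for the lower limits of its terms, then each
term converges to its bound. -/
theorem tendsto_of_tendsto_add [l.NeBot] (ha : a ≤ liminf u l) (hb : b ≤ liminf v l)
    (h : Tendsto (fun i => u i + v i) l (𝓝 (a + b))) (hab : a + b ≠ ⊤) :
    Tendsto u l (𝓝 a) ∧ Tendsto v l (𝓝 b) := by
  refine ⟨tendsto_left_of_tendsto_add ha hb h hab, ?_⟩
  rw [add_comm a b] at h hab
  exact tendsto_left_of_tendsto_add hb ha (h.congr fun i => add_comm _ _) hab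

end ENNReal

/-! ### The dipole part and the mass part of a dipolyhedron -/

section Parts

variable {E : Type*} [NormedAddCommGroup E]

section Current

variable [NormedSpace ℝ E]

/-- The left inverse `T ↦ (η ↦ T(s · η))` of `dipoleOp`, which vanishes on mass cells. -/
noncomputable def dipolePartOp (k : ℕ) : Current (E × ℝ) k →+ Current E k where
  toFun T :=
    { toFun := fun η => T (lift η)
      map_add' := fun η θ => by
        rw [← map_add]
        congr 1
        ext z w
        simp [lift, mul_add]
      map_smul' := fun c η => by
        rw [← map_smul]
        congr 1
        ext z w
        simp [lift, mul_left_comm] }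
  map_zero' := rfl
  map_add' _ _ := rfl

theorem dipolePartOp_dipoleOp {k : ℕ} (T : Current E k) : dipolePartOp k (dipoleOp k T) = T :=
  LinearMap.ext fun η => dipoleOp_lift T η

theorem dipolePartOp_massOp {k : ℕ} (T : Current E k) :
    dipolePartOp (k + 1) (massOp k T) = 0 :=
  LinearMap.ext fun η => massOp_lift T η

end Current

variable [InnerProductSpace ℝ E]

theorem dipolePartOp_mem {k : ℕ} (D : Current (E × ℝ) k) (hD : D ∈ IntDipolyhedron E k) :
    dipolePartOp k D ∈ IntChain E k := by
  obtain ⟨S, hS, T, hT, rfl⟩ := Submodule.mem_sup.1 hD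
  obtain ⟨B, hB, rfl⟩ := exists_of_mem_intDipoleChain hS
  rw [map_add, dipolePartOp_dipoleOp]
  refine Submodule.add_mem _ hB ?_
  cases k with
  | zero =>
    rw [intMassChain_zero, Submodule.mem_bot] at hT
    rw [hT, map_zero]
    exact Submodule.zero_mem _
  | succ k =>
    obtain ⟨C, -, rfl⟩ := exists_of_mem_intMassChain hT
    rw [dipolePartOp_massOp]
    exact Submodule.zero_mem _

/-- The chain `B` of a dipolyhedron `δB + μC`. -/
noncomputable def dipolePart (k : ℕ) : Dipolyhedron E k →+ PolyChain E k :=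
  mod2Map (dipolePartOp k) (IntDipolyhedron E k) (IntChain E k) dipolePartOp_mem

/-- The chain `C` of a dipolyhedron `D = δB + μC`.  It is read off from the boundary
`∂D = δ(∂B + C) - μ∂C`, as the dipole part of `∂D` less `∂B`. -/
noncomputable def massPart (k : ℕ) : Dipolyhedron E (k + 1) →+ PolyChain E k :=
  (dipolePart k).comp (dipBdry k) - (polyBdry k).comp (dipolePart (k + 1))

theorem massPart_apply {k : ℕ} (D : Dipolyhedron E (k + 1)) :
    massPart k D = dipolePart k (dipBdry k D) - polyBdry k (dipolePart (k + 1) D) := rfl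

@[simp] theorem dipolePart_polyDelta {k : ℕ} (P : PolyChain E k) :
    dipolePart k (polyDelta k P) = P := by
  have : (dipolePart k).comp (polyDelta k) = AddMonoidHom.id (PolyChain E k) :=
    mod2_hom_ext fun p e =>
      congrArg (· ⊗ₜ[ℤ] e) (Subtype.ext (dipolePartOp_dipoleOp p.1))
  exact DFunLike.congr_fun this P

@[simp] theorem dipolePart_polyMu {k : ℕ} (P : PolyChain E k) :
    dipolePart (k + 1) (polyMu k P) = 0 := by
  have : (dipolePart (k + 1)).comp (polyMu k) = (0 : PolyChain E k →+ PolyChain E (k + 1)) := by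
    refine mod2_hom_ext fun p e => ?_
    have e1 : (⟨dipolePartOp (k + 1) (massOp k p.1), dipolePartOp_mem _ (massOp_mem' _ p.2)⟩ :
        IntChain E (k + 1)) = 0 := Subtype.ext (dipolePartOp_massOp p.1)
    exact (congrArg (· ⊗ₜ[ℤ] e) e1).trans (TensorProduct.zero_tmul _ _)
  exact DFunLike.congr_fun this P

@[simp] theorem massPart_polyDelta {k : ℕ} (P : PolyChain E (k + 1)) :
    massPart k (polyDelta (k + 1) P) = 0 := by
  rw [massPart_apply, dipBdry_polyDelta, dipolePart_polyDelta, dipolePart_polyDelta, sub_self]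

@[simp] theorem massPart_polyMu {k : ℕ} (P : PolyChain E k) :
    massPart k (polyMu k P) = P := by
  rw [massPart_apply, dipolePart_polyMu, map_zero, sub_zero]
  cases k with
  | zero => rw [dipBdry_polyMu_zero, dipolePart_polyDelta]
  | succ k => rw [dipBdry_polyMu, map_sub, dipolePart_polyDelta, dipolePart_polyMu, sub_zero]

theorem polyDelta_dipolePart_zero (D : Dipolyhedron E 0) : polyDelta 0 (dipolePart 0 D) = D := by
  obtain ⟨s, rfl⟩ := exists_dipCell_sum D
  induction s using Multiset.induction_on with
  | empty => simp
  | cons c s ih =>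
    rw [Multiset.map_cons, Multiset.sum_cons, map_add, map_add, ih]
    congr 1
    cases c with
    | inl σ => exact congrArg (polyDelta 0) (dipolePart_polyDelta (polyCell σ))
    | inr σ => exact PEmpty.elim σ

theorem polyDelta_dipolePart_add_polyMu_massPart {k : ℕ} (D : Dipolyhedron E (k + 1)) :
    polyDelta (k + 1) (dipolePart (k + 1) D) + polyMu k (massPart k D) = D := by
  obtain ⟨s, rfl⟩ := exists_dipCell_sum D
  induction s using Multiset.induction_on with
  | empty => simp
  | cons c s ih =>
    rw [Multiset.map_cons, Multiset.sum_cons]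
    simp only [map_add]
    rw [add_add_add_comm, ih]
    congr 1
    cases c with
    | inl σ =>
      change polyDelta (k + 1) (dipolePart (k + 1) (polyDelta (k + 1) (polyCell σ))) +
        polyMu k (massPart k (polyDelta (k + 1) (polyCell σ))) = polyDelta (k + 1) (polyCell σ)
      simp
    | inr σ =>
      change polyDelta (k + 1) (dipolePart (k + 1) (polyMu k (polyCell σ))) +
        polyMu k (massPart k (polyMu k (polyCell σ))) = polyMu k (polyCell σ)
      simp

/-! ### Energy of the two parts -/

theorem polyMass_polyCell_le {k : ℕ} (σ : Simplex E k) : polyMass k (polyCell σ) ≤ σ.vol := by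
  have h := cellSize_le (cell := polyCell) (Simplex.vol_nonneg (E := E) (k := k)) {σ}
  simp only [Multiset.map_singleton, Multiset.sum_singleton] at h
  exact h

theorem polyMass_add_polyMass_le {k : ℕ} (s : Multiset (Simplex E (k + 1) ⊕ MassIndex E (k + 1))) :
    polyMass (k + 1) (dipolePart (k + 1) (s.map (dipCell2 (k + 1))).sum) +
      polyMass k (massPart k (s.map (dipCell2 (k + 1))).sum) ≤
      (s.map (dipCellVol (k + 1))).sum := by
  induction s using Multiset.induction_on with
  | empty => simp
  | cons c s ih =>
    simp only [Multiset.map_cons, Multiset.sum_cons, map_add]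
    have h1 := map_add_le_add (polyMass (k + 1)) (dipolePart (k + 1) (dipCell2 (k + 1) c))
      (dipolePart (k + 1) (s.map (dipCell2 (k + 1))).sum)
    have h2 := map_add_le_add (polyMass k) (massPart k (dipCell2 (k + 1) c))
      (massPart k (s.map (dipCell2 (k + 1))).sum)
    suffices h : polyMass (k + 1) (dipolePart (k + 1) (dipCell2 (k + 1) c)) +
        polyMass k (massPart k (dipCell2 (k + 1) c)) ≤ dipCellVol (k + 1) c by linarith
    cases c with
    | inl σ =>
      change polyMass (k + 1) (dipolePart (k + 1) (polyDelta (k + 1) (polyCell σ))) +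
        polyMass k (massPart k (polyDelta (k + 1) (polyCell σ))) ≤ σ.vol
      simpa using polyMass_polyCell_le σ
    | inr σ =>
      change polyMass (k + 1) (dipolePart (k + 1) (polyMu k (polyCell σ))) +
        polyMass k (massPart k (polyMu k (polyCell σ))) ≤ Simplex.vol (E := E) (k := k) σ
      simpa using polyMass_polyCell_le (E := E) (k := k) σ

theorem energy_eq_add {k : ℕ} (D : Dipolyhedron E (k + 1)) :
    energy (k + 1) D = polyMass (k + 1) (dipolePart (k + 1) D) + polyMass k (massPart k D) := by
  apply le_antisymm
  · conv_lhs => rw [← polyDelta_dipolePart_add_polyMu_massPart D]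
    exact (map_add_le_add (energy (k + 1)) _ _).trans
      (add_le_add (energy_polyDelta_le _) (energy_polyMu_le _))
  · refine le_of_forall_pos_le_add fun ε hε => ?_
    obtain ⟨s, rfl, hs⟩ :=
      exists_lt_of_cellSize (dipCellVol (k + 1)) exists_dipCell_sum D hε
    exact (polyMass_add_polyMass_le s).trans hs.le

theorem energy_zero_eq (D : Dipolyhedron E 0) : energy 0 D = polyMass 0 (dipolePart 0 D) := by
  apply le_antisymm
  · conv_lhs => rw [← polyDelta_dipolePart_zero D]
    exact energy_polyDelta_le _
  · refine cellSize_map_le Simplex.vol_nonneg exists_dipCell_sum (dipolePart 0)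
      (Sum.elim id PEmpty.elim) ?_ ?_ D
    · rintro (σ | σ)
      · exact dipolePart_polyDelta (polyCell σ)
      · exact PEmpty.elim σ
    · rintro (σ | σ)
      · rfl
      · exact PEmpty.elim σ

theorem polyMass_dipolePart_le : {k : ℕ} → (D : Dipolyhedron E k) →
    polyMass k (dipolePart k D) ≤ energy k D
  | 0, D => (energy_zero_eq D).ge
  | k + 1, D => by
    rw [energy_eq_add]
    exact le_add_of_nonneg_right (apply_nonneg _ _)

theorem polyMass_massPart_le {k : ℕ} (D : Dipolyhedron E (k + 1)) :
    polyMass k (massPart k D) ≤ energy (k + 1) D := by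
  rw [energy_eq_add]
  exact le_add_of_nonneg_left (apply_nonneg _ _)

/-! ### Continuity of the two parts -/

theorem polyBdry_polyBdry {k : ℕ} (P : PolyChain E (k + 2)) :
    polyBdry k (polyBdry (k + 1) P) = 0 := by
  have : (polyBdry k).comp (polyBdry (k + 1)) = (0 : PolyChain E (k + 2) →+ PolyChain E k) := by
    refine mod2_hom_ext fun p e => ?_
    have e1 : (⟨bdry k (bdry (k + 1) p.1), bdry_mem_intChain _ (bdry_mem_intChain _ p.2)⟩ :
        IntChain E k) = 0 := Subtype.ext (bdry_bdry p.1)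
    exact (congrArg (· ⊗ₜ[ℤ] e) e1).trans (TensorProduct.zero_tmul _ _)
  exact DFunLike.congr_fun this P

theorem dipBdry_dipBdry {k : ℕ} (D : Dipolyhedron E (k + 2)) :
    dipBdry k (dipBdry (k + 1) D) = 0 := by
  have : (dipBdry k).comp (dipBdry (k + 1)) =
      (0 : Dipolyhedron E (k + 2) →+ Dipolyhedron E k) := by
    refine mod2_hom_ext fun p e => ?_
    have e1 : (⟨bdry k (bdry (k + 1) p.1),
        bdry_mem_intDipolyhedron _ (bdry_mem_intDipolyhedron _ p.2)⟩ :
        IntDipolyhedron E k) = 0 := Subtype.ext (bdry_bdry p.1)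
    exact (congrArg (· ⊗ₜ[ℤ] e) e1).trans (TensorProduct.zero_tmul _ _)
  exact DFunLike.congr_fun this D

theorem dipolePart_dipBdry {k : ℕ} (D : Dipolyhedron E (k + 1)) :
    dipolePart k (dipBdry k D) = massPart k D + polyBdry k (dipolePart (k + 1) D) := by
  rw [massPart_apply, sub_add_cancel]

/-- The mass part anticommutes with the boundary, hence commutes with it modulo two. -/
theorem massPart_dipBdry {k : ℕ} (D : Dipolyhedron E (k + 2)) :
    massPart k (dipBdry (k + 1) D) = polyBdry k (massPart (k + 1) D) := by
  rw [massPart_apply, dipBdry_dipBdry, dipolePart_dipBdry, map_add, polyBdry_polyBdry, map_zero,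
    zero_sub, add_zero, PolyChain.neg_eq]

theorem norm_dipolePart_le {k : ℕ} (D : Dipolyhedron E k) : ‖dipolePart k D‖ ≤ 1 * ‖D‖ := by
  rw [one_mul, PolyChain.norm_def, Dipolyhedron.norm_def]
  refine le_flatSeminorm _ _ _ _ _ fun Q R h => ?_
  rw [h, map_add, dipolePart_dipBdry, ← add_assoc, energy_eq_add]
  refine (flatSeminorm_le _ _ _ _ _).trans ?_
  linarith [map_add_le_add (polyMass k) (dipolePart k Q) (massPart k R), polyMass_dipolePart_le Q]

theorem norm_massPart_le {k : ℕ} (D : Dipolyhedron E (k + 1)) : ‖massPart k D‖ ≤ 1 * ‖D‖ := by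
  rw [one_mul, PolyChain.norm_def, Dipolyhedron.norm_def]
  refine le_flatSeminorm _ _ _ _ _ fun Q R h => ?_
  rw [h, map_add, massPart_dipBdry]
  exact (flatSeminorm_le _ _ _ _ _).trans
    (add_le_add (polyMass_massPart_le Q) (polyMass_massPart_le R))

/-! ### Flat dipolyhedra -/

/-- The continuous extension of `dipolePart` to flat dipolyhedra. -/
noncomputable def flatDipolePart (k : ℕ) :
    NormedAddGroupHom (FlatDipolyhedron E k) (FlatChain E k) :=
  (AddMonoidHom.mkNormedAddGroupHom (dipolePart k) 1 norm_dipolePart_le).completion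

/-- The continuous extension of `massPart` to flat dipolyhedra. -/
noncomputable def flatMassPart (k : ℕ) :
    NormedAddGroupHom (FlatDipolyhedron E (k + 1)) (FlatChain E k) :=
  (AddMonoidHom.mkNormedAddGroupHom (massPart k) 1 norm_massPart_le).completion

theorem flatDipolePart_coe {k : ℕ} (D : Dipolyhedron E k) :
    flatDipolePart k (D : FlatDipolyhedron E k) = (dipolePart k D : FlatChain E k) :=
  NormedAddGroupHom.completion_coe _ _

theorem flatMassPart_coe {k : ℕ} (D : Dipolyhedron E (k + 1)) :
    flatMassPart k (D : FlatDipolyhedron E (k + 1)) = (massPart k D : FlatChain E k) :=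
  NormedAddGroupHom.completion_coe _ _

theorem delta_coe {k : ℕ} (P : PolyChain E k) :
    delta k (P : FlatChain E k) = (polyDelta k P : FlatDipolyhedron E k) :=
  NormedAddGroupHom.completion_coe _ _

theorem mu_coe {k : ℕ} (P : PolyChain E k) :
    mu k (P : FlatChain E k) = (polyMu k P : FlatDipolyhedron E (k + 1)) :=
  NormedAddGroupHom.completion_coe _ _

theorem flatDipolePart_delta {k : ℕ} (B : FlatChain E k) :
    flatDipolePart k (delta k B) = B := by
  induction B using UniformSpace.Completion.induction_on with
  | hp => exact isClosed_eq ((flatDipolePart k).continuous.comp (delta k).continuous) continuous_id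
  | ih P => rw [delta_coe, flatDipolePart_coe, dipolePart_polyDelta]

theorem flatDipolePart_mu {k : ℕ} (C : FlatChain E k) :
    flatDipolePart (k + 1) (mu k C) = 0 := by
  induction C using UniformSpace.Completion.induction_on with
  | hp =>
    exact isClosed_eq ((flatDipolePart (k + 1)).continuous.comp (mu k).continuous) continuous_const
  | ih P => rw [mu_coe, flatDipolePart_coe, dipolePart_polyMu, UniformSpace.Completion.coe_zero]

theorem flatMassPart_delta {k : ℕ} (B : FlatChain E (k + 1)) :
    flatMassPart k (delta (k + 1) B) = 0 := by
  induction B using UniformSpace.Completion.induction_on with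
  | hp =>
    exact isClosed_eq ((flatMassPart k).continuous.comp (delta (k + 1)).continuous)
      continuous_const
  | ih P => rw [delta_coe, flatMassPart_coe, massPart_polyDelta, UniformSpace.Completion.coe_zero]

theorem flatMassPart_mu {k : ℕ} (C : FlatChain E k) :
    flatMassPart k (mu k C) = C := by
  induction C using UniformSpace.Completion.induction_on with
  | hp => exact isClosed_eq ((flatMassPart k).continuous.comp (mu k).continuous) continuous_id
  | ih P => rw [mu_coe, flatMassPart_coe, massPart_polyMu]

theorem delta_flatDipolePart_zero (A : FlatDipolyhedron E 0) :
    delta 0 (flatDipolePart 0 A) = A := by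
  induction A using UniformSpace.Completion.induction_on with
  | hp => exact isClosed_eq ((delta 0).continuous.comp (flatDipolePart 0).continuous) continuous_id
  | ih D => rw [flatDipolePart_coe, delta_coe, polyDelta_dipolePart_zero]

theorem delta_add_mu_eq_self {k : ℕ} (A : FlatDipolyhedron E (k + 1)) :
    delta (k + 1) (flatDipolePart (k + 1) A) + mu k (flatMassPart k A) = A := by
  induction A using UniformSpace.Completion.induction_on with
  | hp =>
    exact isClosed_eq
      (((delta (k + 1)).continuous.comp (flatDipolePart (k + 1)).continuous).add
        ((mu k).continuous.comp (flatMassPart k).continuous)) continuous_id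
  | ih D =>
    rw [flatDipolePart_coe, flatMassPart_coe, delta_coe, mu_coe, ← UniformSpace.Completion.coe_add,
      polyDelta_dipolePart_add_polyMu_massPart]

theorem tendsto_dipolePart {k : ℕ} {D : ℕ → Dipolyhedron E k} {A : FlatDipolyhedron E k}
    (h : Tendsto (fun i => (D i : FlatDipolyhedron E k)) atTop (𝓝 A)) :
    Tendsto (fun i => (dipolePart k (D i) : FlatChain E k)) atTop (𝓝 (flatDipolePart k A)) := by
  simpa only [Function.comp_def, flatDipolePart_coe] using
    ((flatDipolePart k).continuous.tendsto A).comp h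

theorem tendsto_massPart {k : ℕ} {D : ℕ → Dipolyhedron E (k + 1)} {A : FlatDipolyhedron E (k + 1)}
    (h : Tendsto (fun i => (D i : FlatDipolyhedron E (k + 1))) atTop (𝓝 A)) :
    Tendsto (fun i => (massPart k (D i) : FlatChain E k)) atTop (𝓝 (flatMassPart k A)) := by
  simpa only [Function.comp_def, flatMassPart_coe] using
    ((flatMassPart k).continuous.tendsto A).comp h

theorem ofReal_energy {k : ℕ} (D : Dipolyhedron E (k + 1)) :
    ENNReal.ofReal (energy (k + 1) D) =
      ENNReal.ofReal (polyMass (k + 1) (dipolePart (k + 1) D)) +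
        ENNReal.ofReal (polyMass k (massPart k D)) := by
  rw [energy_eq_add, ENNReal.ofReal_add (apply_nonneg _ _) (apply_nonneg _ _)]

theorem flatMass_le_liminf_polyMass {k : ℕ} {P : ℕ → PolyChain E k} {B : FlatChain E k}
    (h : Tendsto (fun i => (P i : FlatChain E k)) atTop (𝓝 B)) :
    flatMass B ≤ liminf (fun i => ENNReal.ofReal (polyMass k (P i))) atTop :=
  iInf₂_le P h

theorem flatMass_le_liminf_flatMass {k : ℕ} {u : ℕ → FlatChain E k} {B : FlatChain E k}
    (h : Tendsto u atTop (𝓝 B)) : flatMass B ≤ liminf (fun i => flatMass (u i)) atTop :=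
  relax_le_liminf_relax (f := fun P => ENNReal.ofReal (polyMass k P)) h

theorem flatEnergy_le_liminf_energy {k : ℕ} {D : ℕ → Dipolyhedron E k} {A : FlatDipolyhedron E k}
    (h : Tendsto (fun i => (D i : FlatDipolyhedron E k)) atTop (𝓝 A)) :
    flatEnergy A ≤ liminf (fun i => ENNReal.ofReal (energy k (D i))) atTop :=
  iInf₂_le D h

theorem exists_polyMass_lt_of_flatMass_lt {k : ℕ} {B : FlatChain E k} {c : ENNReal}
    (h : flatMass B < c) {U : Set (FlatChain E k)} (hU : U ∈ 𝓝 B) :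
    ∃ P : PolyChain E k, (P : FlatChain E k) ∈ U ∧ ENNReal.ofReal (polyMass k P) < c :=
  exists_lt_of_relax_lt (f := fun P => ENNReal.ofReal (polyMass k P)) h hU

theorem flatEnergy_zero (A : FlatDipolyhedron E 0) :
    flatEnergy A = flatMass (flatDipolePart 0 A) := by
  apply le_antisymm
  · refine le_iInf₂ fun P hP => ?_
    have h := ((delta 0).continuous.tendsto _).comp hP
    rw [delta_flatDipolePart_zero] at h
    have h' : Tendsto (fun i => (polyDelta 0 (P i) : FlatDipolyhedron E 0)) atTop (𝓝 A) :=
      h.congr fun i => delta_coe (P i)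
    refine (flatEnergy_le_liminf_energy h').trans_eq ?_
    simp only [energy_zero_eq, dipolePart_polyDelta]
  · refine le_iInf₂ fun D hD => ?_
    simp only [energy_zero_eq]
    exact flatMass_le_liminf_polyMass (tendsto_dipolePart hD)

theorem flatEnergy_eq_add {k : ℕ} (A : FlatDipolyhedron E (k + 1)) :
    flatEnergy A = flatMass (flatDipolePart (k + 1) A) + flatMass (flatMassPart k A) := by
  apply le_antisymm
  · refine ENNReal.le_of_forall_pos_le_add fun ε hε hfin => ?_
    obtain ⟨hB, hC⟩ := ENNReal.add_lt_top.1 hfin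
    have hε2 : (ε / 2 : ENNReal) ≠ 0 := by simpa using hε.ne'
    rw [← ENNReal.add_halves (ε : ENNReal), add_add_add_comm]
    refine relax_le_of_forall_nhds (f := fun D => ENNReal.ofReal (energy (k + 1) D)) fun U hU => ?_
    have hcont : Continuous fun x : FlatChain E (k + 1) × FlatChain E k =>
        delta (k + 1) x.1 + mu k x.2 :=
      ((delta (k + 1)).continuous.comp continuous_fst).add ((mu k).continuous.comp continuous_snd)
    have hpre := hcont.tendsto (flatDipolePart (k + 1) A, flatMassPart k A)
    rw [delta_add_mu_eq_self] at hpre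
    obtain ⟨V, hV, W, hW, hVW⟩ := mem_nhds_prod_iff.1 (hpre hU)
    obtain ⟨P, hPV, hP⟩ := exists_polyMass_lt_of_flatMass_lt (ENNReal.lt_add_right hB.ne hε2) hV
    obtain ⟨Q, hQW, hQ⟩ := exists_polyMass_lt_of_flatMass_lt (ENNReal.lt_add_right hC.ne hε2) hW
    refine ⟨polyDelta (k + 1) P + polyMu k Q, ?_, ?_⟩
    · rw [UniformSpace.Completion.coe_add, ← delta_coe, ← mu_coe]
      exact hVW (Set.mk_mem_prod hPV hQW)
    · rw [ofReal_energy]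
      simpa using add_le_add hP.le hQ.le
  · refine le_iInf₂ fun D hD => ?_
    simp only [ofReal_energy]
    exact add_le_liminf_add (flatMass_le_liminf_polyMass (tendsto_dipolePart hD))
      (flatMass_le_liminf_polyMass (tendsto_massPart hD))

end Parts

end Dipole

open Dipole in
theorem mainTheorem4 :
    -- flat dipolyhedra of dimension `k + 1 ≥ 1`
    (∀ (k : ℕ) (A : Dipole.FlatDipolyhedron (EuclideanSpace ℝ (Fin 3)) (k + 1)),
      ∃ (B : Dipole.FlatChain (EuclideanSpace ℝ (Fin 3)) (k + 1))
        (C : Dipole.FlatChain (EuclideanSpace ℝ (Fin 3)) k),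
        A = Dipole.delta (k + 1) B + Dipole.mu k C ∧
        (∀ (B' : Dipole.FlatChain (EuclideanSpace ℝ (Fin 3)) (k + 1))
          (C' : Dipole.FlatChain (EuclideanSpace ℝ (Fin 3)) k),
          A = Dipole.delta (k + 1) B' + Dipole.mu k C' → B' = B ∧ C' = C) ∧
        Dipole.flatEnergy A = Dipole.flatMass B + Dipole.flatMass C ∧
        -- convergence, for dipolyhedra `D_i = δB_i + μC_i`
        (∀ (Bs : ℕ → Dipole.PolyChain (EuclideanSpace ℝ (Fin 3)) (k + 1))
          (Cs : ℕ → Dipole.PolyChain (EuclideanSpace ℝ (Fin 3)) k)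
          (Ds : ℕ → Dipole.Dipolyhedron (EuclideanSpace ℝ (Fin 3)) (k + 1)),
          (∀ i, Ds i = Dipole.polyDelta (k + 1) (Bs i) + Dipole.polyMu k (Cs i)) →
          Tendsto (fun i => (Ds i : Dipole.FlatDipolyhedron (EuclideanSpace ℝ (Fin 3)) (k + 1)))
            atTop (𝓝 A) →
          Tendsto (fun i => ENNReal.ofReal (Dipole.energy (k + 1) (Ds i))) atTop
            (𝓝 (Dipole.flatEnergy A)) →
          Tendsto (fun i => (Bs i : Dipole.FlatChain (EuclideanSpace ℝ (Fin 3)) (k + 1)))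
            atTop (𝓝 B) ∧
          Tendsto (fun i => (Cs i : Dipole.FlatChain (EuclideanSpace ℝ (Fin 3)) k)) atTop (𝓝 C) ∧
          (Dipole.flatEnergy A ≠ ⊤ →
            Tendsto (fun i => ENNReal.ofReal (Dipole.polyMass (k + 1) (Bs i))) atTop
              (𝓝 (Dipole.flatMass B)) ∧
            Tendsto (fun i => ENNReal.ofReal (Dipole.polyMass k (Cs i))) atTop
              (𝓝 (Dipole.flatMass C)))) ∧
        -- convergence, for flat dipolyhedra `D_i = δB_i + μC_i`
        (∀ (Bs : ℕ → Dipole.FlatChain (EuclideanSpace ℝ (Fin 3)) (k + 1))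
          (Cs : ℕ → Dipole.FlatChain (EuclideanSpace ℝ (Fin 3)) k)
          (Ds : ℕ → Dipole.FlatDipolyhedron (EuclideanSpace ℝ (Fin 3)) (k + 1)),
          (∀ i, Ds i = Dipole.delta (k + 1) (Bs i) + Dipole.mu k (Cs i)) →
          Tendsto Ds atTop (𝓝 A) →
          Tendsto (fun i => Dipole.flatEnergy (Ds i)) atTop (𝓝 (Dipole.flatEnergy A)) →
          Tendsto Bs atTop (𝓝 B) ∧ Tendsto Cs atTop (𝓝 C) ∧
          (Dipole.flatEnergy A ≠ ⊤ →
            Tendsto (fun i => Dipole.flatMass (Bs i)) atTop (𝓝 (Dipole.flatMass B)) ∧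
            Tendsto (fun i => Dipole.flatMass (Cs i)) atTop (𝓝 (Dipole.flatMass C))))) ∧
    -- flat dipolyhedra of dimension `0`, where the part `μC` is absent
    (∀ A : Dipole.FlatDipolyhedron (EuclideanSpace ℝ (Fin 3)) 0,
      ∃ B : Dipole.FlatChain (EuclideanSpace ℝ (Fin 3)) 0,
        A = Dipole.delta 0 B ∧
        (∀ B' : Dipole.FlatChain (EuclideanSpace ℝ (Fin 3)) 0, A = Dipole.delta 0 B' → B' = B) ∧
        Dipole.flatEnergy A = Dipole.flatMass B ∧
        (∀ (Bs : ℕ → Dipole.PolyChain (EuclideanSpace ℝ (Fin 3)) 0)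
          (Ds : ℕ → Dipole.Dipolyhedron (EuclideanSpace ℝ (Fin 3)) 0),
          (∀ i, Ds i = Dipole.polyDelta 0 (Bs i)) →
          Tendsto (fun i => (Ds i : Dipole.FlatDipolyhedron (EuclideanSpace ℝ (Fin 3)) 0))
            atTop (𝓝 A) →
          Tendsto (fun i => ENNReal.ofReal (Dipole.energy 0 (Ds i))) atTop
            (𝓝 (Dipole.flatEnergy A)) →
          Tendsto (fun i => (Bs i : Dipole.FlatChain (EuclideanSpace ℝ (Fin 3)) 0)) atTop (𝓝 B) ∧
          Tendsto (fun i => ENNReal.ofReal (Dipole.polyMass 0 (Bs i))) atTop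
            (𝓝 (Dipole.flatMass B))) ∧
        (∀ (Bs : ℕ → Dipole.FlatChain (EuclideanSpace ℝ (Fin 3)) 0)
          (Ds : ℕ → Dipole.FlatDipolyhedron (EuclideanSpace ℝ (Fin 3)) 0),
          (∀ i, Ds i = Dipole.delta 0 (Bs i)) →
          Tendsto Ds atTop (𝓝 A) →
          Tendsto (fun i => Dipole.flatEnergy (Ds i)) atTop (𝓝 (Dipole.flatEnergy A)) →
          Tendsto Bs atTop (𝓝 B) ∧
          Tendsto (fun i => Dipole.flatMass (Bs i)) atTop (𝓝 (Dipole.flatMass B)))) := by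
  refine ⟨fun k A => ⟨flatDipolePart (k + 1) A, flatMassPart k A,
    (delta_add_mu_eq_self A).symm, ?_, flatEnergy_eq_add A, ?_, ?_⟩,
    fun A => ⟨flatDipolePart 0 A, (delta_flatDipolePart_zero A).symm, ?_, flatEnergy_zero A,
    ?_, ?_⟩⟩
  · rintro B C rfl
    simp [flatDipolePart_delta, flatDipolePart_mu, flatMassPart_delta, flatMassPart_mu]
  · intro Bs Cs Ds hD hlim hE
    obtain rfl : Bs = fun i => dipolePart (k + 1) (Ds i) := funext fun i => by
      rw [hD i, map_add, dipolePart_polyDelta, dipolePart_polyMu, add_zero]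
    obtain rfl : Cs = fun i => massPart k (Ds i) := funext fun i => by
      rw [hD i, map_add, massPart_polyDelta, massPart_polyMu, zero_add]
    have h1 := tendsto_dipolePart hlim
    have h2 := tendsto_massPart hlim
    refine ⟨h1, h2, fun hfin => ?_⟩
    simp only [ofReal_energy] at hE
    rw [flatEnergy_eq_add] at hE hfin
    exact tendsto_of_tendsto_add (flatMass_le_liminf_polyMass h1)
      (flatMass_le_liminf_polyMass h2) hE hfin
  · intro Bs Cs Ds hD hlim hE
    obtain rfl : Bs = fun i => flatDipolePart (k + 1) (Ds i) := funext fun i => by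
      rw [hD i, map_add, flatDipolePart_delta, flatDipolePart_mu, add_zero]
    obtain rfl : Cs = fun i => flatMassPart k (Ds i) := funext fun i => by
      rw [hD i, map_add, flatMassPart_delta, flatMassPart_mu, zero_add]
    have h1 := ((flatDipolePart (k + 1)).continuous.tendsto A).comp hlim
    have h2 := ((flatMassPart k).continuous.tendsto A).comp hlim
    refine ⟨h1, h2, fun hfin => ?_⟩
    simp only [flatEnergy_eq_add] at hE hfin
    exact tendsto_of_tendsto_add (flatMass_le_liminf_flatMass h1)
      (flatMass_le_liminf_flatMass h2) hE hfin
  · rintro B rfl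
    exact (flatDipolePart_delta B).symm
  · intro Bs Ds hD hlim hE
    obtain rfl : Bs = fun i => dipolePart 0 (Ds i) := funext fun i => by
      rw [hD i, dipolePart_polyDelta]
    refine ⟨tendsto_dipolePart hlim, ?_⟩
    simpa only [energy_zero_eq, flatEnergy_zero] using hE
  · intro Bs Ds hD hlim hE
    obtain rfl : Bs = fun i => flatDipolePart 0 (Ds i) := funext fun i => by
      rw [hD i, flatDipolePart_delta]
    refine ⟨((flatDipolePart 0).continuous.tendsto A).comp hlim, ?_⟩
    simpa only [flatEnergy_zero] using hE
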